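/- **Setting.** Let $d\ge 1$, $D,B,P,\sigma>0$ and $\mathrm{SNR}=P/\sigma^2$; $\log$ is to base $2$. Let $\mathcal X\subset\mathbb R^d$ be a nonempty convex set of diameter at most $D$. Let $\mathcal O$ be the set of pairs $(f,O)$ where $f:\mathcal X\to\mathbb R$ is convex and $O$ is an oracle which, when queried at $x\in\mathcal X$, returns (with fresh randomness) a random vector $\hat g(x)\in\mathbb R^d$ with $\mathbb E[\hat g(x)]\in\partial f(x)$ and $\mathbb E\|\hat g(x)\|^2\le B^2$. A code of length $\ell\ge 1$ is a (randomized) encoder $\varphi(\cdot,U):\mathbb R^d\to\mathbb R^\ell$ such that $\mathbb E\|\varphi(\hat g,U)\|^2\le \ell P$ for every random vector $\hat g$ independent of $U$ with $\mathbb E\|\hat g\|^2\le B^2$. The public randomness $U$ is drawn afresh at each use and is revealed to the optimization algorithm. The code is *analog* if $\ell\le d$ and $\varphi(g,U)=\mathbf A(U)g$ for a (random) $\ell\times d$ matrix $\mathbf A(U)$. The *scaled transmission* code is the analog code $\varphi(g)=\frac{\sqrt{Pd}}{B}\,g$ of length $\ell=d$. A (possibly randomized) algorithm $\pi$ makes $T$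 queries. In iteration $t$ it chooses $x_t\in\mathcal X$ from its past observations, the oracle produces $\hat g_t=\hat g(x_t)$, and $\pi$ observes $U_t$ and $Y_t=\varphi(\hat g_t,U_t)+Z_t$, with independent noise $Z_t\sim\mathcal N(0,\sigma^2 I_\ell)$. From all observations it finally outputs a point $\hat x\in\mathcal X$. Its error is $\mathcal E(f,\pi^{\varphi O})=\mathbb E f(\hat x)-\inf_{\mathcal X}f$. For a class $\mathcal C$ of codes put $$\mathcal E^*_{\mathcal C}(N)=\sup_{\mathcal X}\ \inf_{(\pi,\varphi):\ \varphi\in\mathcal C,\ \ell T\le N}\ \sup_{(f,O)\in\mathcal O}\mathcal E(f,\pi^{\varphi O}),$$ and write $\mathcal E^*$, $\mathcal E^*_{analog}$, $\mathcal E^*_{scaled}$ for this quantity when $\mathcal C$ consists of all codes, of the analog codes, and of the scaled transmission code only. **Statement.** There are universal constants $c_1,c_2>0$ such that whenever $\mathrm{SNR}\in(0,1)$ and $N\in\mathbb N$ satisfies $N\ge \frac{d}{\log(1+\mathrm{SNR})}$, $$\frac{c_1DB}{\sqrt N}\sqrt{\frac{d}{\log(1+\mathrm{SNR})}}\ \le\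 \mathcal E^*_{analog}(N)\ \le\ \frac{c_2DB}{\sqrt N}\sqrt{\frac{d}{\log(1+\mathrm{SNR})}} .$$ Moreover analog codes, and specifically scaled transmission, are optimal up to constant factors among all codes: $$\frac{c_1DB}{\sqrt N}\sqrt{\frac{d}{\log(1+\mathrm{SNR})}}\ \le\ \mathcal E^*(N)\qquad\text{and}\qquad \mathcal E^*_{scaled}(N)\ \le\ \frac{c_2DB}{\sqrt N}\sqrt{\frac{d}{\log(1+\mathrm{SNR})}} .$$ -/

import Mathlib

open MeasureTheory ProbabilityTheory
open scoped ENNReal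

namespace OverTheAir

noncomputable section

/-- Euclidean space `ℝⁿ`. -/
abbrev Euc (n : ℕ) : Type := EuclideanSpace ℝ (Fin n)

/-- The admissible domains: nonempty convex sets of diameter at most `D`. -/
def domains (d : ℕ) (D : ℝ) : Set (Set (Euc d)) :=
  {X | X.Nonempty ∧ Convex ℝ X ∧ ∀ x ∈ X, ∀ y ∈ X, ‖x - y‖ ≤ D}

/-- The set of subgradients at `x` of a function `f` on the domain `X`
(the values of `f` outside `X` play no role). -/
def subdifferential {d : ℕ} (X : Set (Euc d)) (f : Euc d → ℝ) (x : Euc d) : Set (Euc d) :=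
  {g | ∀ y ∈ X, f x + inner ℝ g (y - x) ≤ f y}

/-- A pair `(f, O)` of a convex function on `X` and a noisy first-order oracle for it: `O x` is the
law of the subgradient estimate returned when `x` is queried, with fresh randomness at each query.
The estimate is unbiased and has second moment at most `B²`. -/
structure Instance {d : ℕ} (X : Set (Euc d)) (B : ℝ) where
  f : Euc d → ℝ
  convex : ConvexOn ℝ X f
  O : Kernel X (Euc d)
  markov : IsMarkovKernel O
  unbiased : ∀ x : X, (∫ g, g ∂(O x)) ∈ subdifferential X f x
  meanSquare : ∀ x : X, ∫⁻ g, ‖g‖ₑ ^ 2 ∂(O x) ≤ ENNReal.ofReal (B ^ 2)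

/-- A code of length `ℓ` and average power at most `P` for estimates in `ℝᵈ` of second moment at
most `B²`. The encoder is randomized by public randomness with law `lawU`, drawn independently of
the estimate that is encoded. -/
structure Code (d ℓ : ℕ) (B P : ℝ) where
  U : Type
  mU : MeasurableSpace U
  lawU : Measure U
  probU : IsProbabilityMeasure lawU
  enc : Euc d → U → Euc ℓ
  measurable_enc : Measurable (Function.uncurry enc)
  power : ∀ ν : Measure (Euc d), IsProbabilityMeasure ν →
    ∫⁻ g, ‖g‖ₑ ^ 2 ∂ν ≤ ENNReal.ofReal (B ^ 2) →
    ∫⁻ g, ∫⁻ u, ‖enc g u‖ₑ ^ 2 ∂lawU ∂ν ≤ ENNReal.ofReal (ℓ * P)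

attribute [instance] Code.mU Code.probU Instance.markov

/-- The law of the channel noise: `ℓ` independent `N(0, σ²)` coordinates. -/
def noise (ℓ : ℕ) (σ : ℝ) : Measure (Euc ℓ) :=
  (Measure.pi fun _ : Fin ℓ => gaussianReal 0 (σ ^ 2).toNNReal).map (WithLp.toLp 2)

/-- What the algorithm gets to see in one iteration: the public randomness and the channel
output. -/
abbrev Obs {d ℓ : ℕ} {B P : ℝ} (c : Code d ℓ B P) : Type := c.U × Euc ℓ

/-- A (possibly randomized) optimization algorithm on `X` using the code `c`. The query number `t`
(counted from `0`) depends on the private seed and on the `t` observations made so far; the output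
after `T` queries depends on the seed and all `T` observations. -/
structure Algorithm {d ℓ : ℕ} {B P : ℝ} (X : Set (Euc d)) (c : Code d ℓ B P) (T : ℕ) where
  W : Type
  mW : MeasurableSpace W
  lawW : Measure W
  probW : IsProbabilityMeasure lawW
  query : (t : ℕ) → W × (Fin t → Obs c) → X
  measurable_query : ∀ t, Measurable (query t)
  output : W × (Fin T → Obs c) → X
  measurable_output : Measurable output

attribute [instance] Algorithm.mW Algorithm.probW

section Run

variable {d ℓ T : ℕ} {B P : ℝ} {X : Set (Euc d)} {c : Code d ℓ B P}

/-- The law of the observation `(U, φ(ĝ, U) + Z)` after the query `x`, where `ĝ ∼ O x`, the public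
randomness `U` and the noise `Z` are independent. -/
def observe (c : Code d ℓ B P) (σ : ℝ) (O : Kernel X (Euc d)) : Kernel X (Obs c) :=
  (O ×ₖ Kernel.const X (c.lawU.prod (noise ℓ σ))).map
    fun p => (p.2.1, c.enc p.1 p.2.1 + p.2.2)

/-- The joint law of the seed and the first `t` observations when the algorithm is run with the
oracle `O` over the Gaussian channel. -/
def transcript (σ : ℝ) (π : Algorithm X c T) (O : Kernel X (Euc d)) :
    (t : ℕ) → Measure (π.W × (Fin t → Obs c))
  | 0 => π.lawW.map fun w => (w, Fin.elim0)
  | t + 1 =>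
    (transcript σ π O t ⊗ₘ (observe c σ O).comap (π.query t) (π.measurable_query t)).map
      fun q => (q.1.1, Fin.snoc (α := fun _ => Obs c) q.1.2 q.2)

/-- The convergence error: expected value of `f` at the output, minus the infimum of `f` on `X`. -/
def convError (σ : ℝ) (π : Algorithm X c T) (I : Instance X B) : ℝ :=
  (∫ h, I.f (π.output h) ∂(transcript σ π I.O T)) - ⨅ x : X, I.f x

/-- The worst-case convergence error of a protocol over all functions and oracles. -/
def worstError (σ : ℝ) (π : Algorithm X c T) : EReal :=
  ⨆ I : Instance X B, (convError σ π I : EReal)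

end Run

/-- A class of codes, of arbitrary lengths. -/
abbrev CodeClass (d : ℕ) (B P : ℝ) : Type 1 := (ℓ : ℕ) → Set (Code d ℓ B P)

/-- The smallest worst-case error on `X` with at most `N` channel uses and codes from `C`. -/
def minimaxErrorOn {d : ℕ} {B P : ℝ} (C : CodeClass d B P) (σ : ℝ) (N : ℕ)
    (X : Set (Euc d)) : EReal :=
  ⨅ (ℓ : ℕ) (_ : 1 ≤ ℓ) (T : ℕ) (_ : ℓ * T ≤ N) (c : Code d ℓ B P) (_ : c ∈ C ℓ)
    (π : Algorithm X c T), worstError σ π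

/-- The min-max error with at most `N` channel uses and codes from `C`: the supremum over all
admissible domains of the smallest worst-case error. -/
def minimaxError {d : ℕ} {B P : ℝ} (C : CodeClass d B P) (D σ : ℝ) (N : ℕ) : EReal :=
  ⨆ X ∈ domains d D, minimaxErrorOn C σ N X

/-- All codes. -/
def allCodes (d : ℕ) (B P : ℝ) : CodeClass d B P := fun _ => Set.univ

/-- Analog codes: length `ℓ ≤ d`, and `φ(g, U) = A(U) g` for a (random) `ℓ × d` matrix `A(U)`. -/
def analogCodes (d : ℕ) (B P : ℝ) : CodeClass d B P := fun ℓ =>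
  {c | ℓ ≤ d ∧ ∃ A : c.U → Matrix (Fin ℓ) (Fin d) ℝ,
    ∀ g u i, c.enc g u i = ∑ j, A u i j * g j}

/-- The scaled transmission code: length `d`, and `φ(g) = (√(Pd) / B) g`. -/
def scaledTransmission (d : ℕ) (B P : ℝ) : CodeClass d B P := fun ℓ =>
  {c | ∃ h : ℓ = d, ∀ g u i, c.enc g u i = √(P * d) / B * g (Fin.cast h i)}

end

end OverTheAir

/-! Upper bound. Rescaled at the receiver by `B / √(P * d)`, the output of scaled transmission is
the subgradient estimate plus independent centred noise. It is still unbiased, and its second moment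
is at most V = B² + B²σ²/P ≤ 2B²/SNR. Projected stochastic gradient descent with T = ⌊N/d⌋ queries
then has error of order D√(V/T), that is DB√(d/(N·SNR)), and log₂(1+SNR) agrees with SNR up to a
factor 2 on (0,1). The domain need not be closed, so the projection is an approximate one
(`exists_measurable_approx_projection`); `integral_potential_le` is the descent argument.

Lower bound. On a cube of diameter D take the linear functions with gradient (δB/√d)·v for sign
vectors v. The oracle ignores the query and returns B/√d times independent signs of means δvᵢ.
Observations are then i.i.d. whatever the algorithm asks, and optimizing amounts to guessing the
signs vᵢ. Let χᵢ be the chi-square divergence between the laws of one observation before and after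
reversing vᵢ. The crux is `sum_chiSq_le`: ∑ χᵢ ≤ 16δ²·ℓ·SNR, with no factor d. It combines two
facts. For a fixed observation, the effect of reversing vᵢ is the correlation of the likelihood with
a bounded centred function of the i-th sign, and all squared correlations together are bounded by
the entropy of the likelihood (`sum_sq_le_entropy`, from the Gibbs variational inequality and
Hoeffding's lemma). Integrated over observations, that entropy is the relative entropy of the
channel output to pure noise, which equals transmitted power over 2σ² (`integral_exp_mul_logRatio`).

Thus Tℓ ≤ N channel uses supply information of order δ²·N·SNR to be shared by d signs. With δ of
order √(d/(N log₂(1+SNR))) this leaves a constant fraction of the signs undecided, and the error is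
of order δDB (`exists_le_convError`).

Scaled transmission is analog, so the bounds for analog codes follow by monotonicity in the class.
-/

namespace OverTheAir

noncomputable section

/-! ### Gaussian noise -/

/-- A product of measures with densities has the product of the densities as its density. -/
lemma pi_withDensity {ι : Type*} [Fintype ι] (μ : ι → Measure ℝ) [∀ i, IsProbabilityMeasure (μ i)]
    (f : ι → ℝ → ℝ≥0∞) (hf : ∀ i, Measurable (f i))
    [∀ i, SigmaFinite ((μ i).withDensity (f i))] :
    Measure.pi (fun i => (μ i).withDensity (f i)) =
      (Measure.pi μ).withDensity (fun x => ∏ i, f i (x i)) := by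
  classical
  refine Measure.pi_eq fun s hs => ?_
  rw [withDensity_apply _ (MeasurableSet.univ_pi hs), ← lintegral_indicator (MeasurableSet.univ_pi hs)]
  -- The indicator of a box factors over the coordinates, so independence of the coordinates splits
  -- the integral.
  have h1 : (Set.univ.pi s).indicator (fun x : ι → ℝ => ∏ i, f i (x i)) =
      fun x => ∏ i, (s i).indicator (f i) (x i) := by
    ext x
    by_cases hx : x ∈ Set.univ.pi s
    · rw [Set.indicator_of_mem hx]
      exact Finset.prod_congr rfl fun i _ => (Set.indicator_of_mem (hx i trivial) _).symm
    · rw [Set.indicator_of_notMem hx]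
      obtain ⟨i, hi⟩ : ∃ i, x i ∉ s i := by simpa [Set.mem_pi] using hx
      exact (Finset.prod_eq_zero (Finset.mem_univ i) (Set.indicator_of_notMem hi _)).symm
  have hm : ∀ i, Measurable ((s i).indicator (f i)) := fun i => (hf i).indicator (hs i)
  rw [h1, lintegral_prod_eq_prod_lintegral_of_indepFun Finset.univ
    (fun i (x : ι → ℝ) => (s i).indicator (f i) (x i))
    (iIndepFun_pi (μ := μ) (X := fun i => (s i).indicator (f i)) fun i => (hm i).aemeasurable)
    fun i => (hm i).comp (measurable_pi_apply i)]
  refine Finset.prod_congr rfl fun i _ => ?_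
  rw [(measurePreserving_eval μ i).lintegral_comp (hm i), lintegral_indicator (hs i),
    withDensity_apply _ (hs i)]

/-- The likelihood ratio of a shifted Gaussian with respect to the centred one. -/
lemma gaussianReal_eq_withDensity (a : ℝ) {v : NNReal} (hv : v ≠ 0) :
    gaussianReal a v =
      (gaussianReal 0 v).withDensity fun x => ENNReal.ofReal (Real.exp ((a * x - a ^ 2 / 2) / v)) := by
  rw [gaussianReal_of_var_ne_zero _ hv, gaussianReal_of_var_ne_zero _ hv,
    ← withDensity_mul _ (measurable_gaussianPDF _ _) (by fun_prop)]
  congr 1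
  ext x
  have : (v : ℝ) ≠ 0 := by exact_mod_cast hv
  rw [Pi.mul_apply, gaussianPDF_def, gaussianPDF_def,
    ← ENNReal.ofReal_mul (gaussianPDFReal_nonneg _ _ _), gaussianPDFReal_def, gaussianPDFReal_def]
  simp only
  rw [mul_assoc _ (Real.exp _) (Real.exp _), ← Real.exp_add]
  congr 3
  field_simp
  ring

instance isProbabilityMeasure_noise (ℓ : ℕ) (σ : ℝ) : IsProbabilityMeasure (noise ℓ σ) :=
  Measure.isProbabilityMeasure_map (by fun_prop)

/-- The likelihood ratio of the law of the noise shifted by `a` with respect to that of the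
noise. -/
lemma noise_map_const_add (ℓ : ℕ) {σ : ℝ} (hσ : 0 < σ) (a : Euc ℓ) :
    (noise ℓ σ).map (fun z => a + z) = (noise ℓ σ).withDensity fun y =>
      ENNReal.ofReal (Real.exp ((inner ℝ a y - ‖a‖ ^ 2 / 2) / σ ^ 2)) := by
  have hv : (σ ^ 2).toNNReal ≠ 0 := by simpa using hσ.ne'
  have hv' : ((σ ^ 2).toNNReal : ℝ) = σ ^ 2 := Real.coe_toNNReal _ (by positivity)
  have hpi : (Measure.pi fun _ : Fin ℓ => gaussianReal 0 (σ ^ 2).toNNReal).map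
      (fun x i => a i + x i) = Measure.pi fun i => gaussianReal (a i) (σ ^ 2).toNNReal := by
    have h0 : ∀ i, (gaussianReal 0 (σ ^ 2).toNNReal).map (fun x => a i + x) =
        gaussianReal (a i) (σ ^ 2).toNNReal := fun i => by
      rw [gaussianReal_map_const_add]; simp
    have : ∀ i, IsProbabilityMeasure ((gaussianReal 0 (σ ^ 2).toNNReal).map (fun x => a i + x)) :=
      fun i => by rw [h0]; infer_instance
    rw [← funext h0]
    exact Measure.pi_map_pi (fun i => (by fun_prop))
  have hd : (Measure.pi fun i => gaussianReal (a i) (σ ^ 2).toNNReal) =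
      (Measure.pi fun _ : Fin ℓ => gaussianReal 0 (σ ^ 2).toNNReal).withDensity fun x =>
        ENNReal.ofReal (Real.exp ((inner ℝ a (WithLp.toLp 2 x) - ‖a‖ ^ 2 / 2) / σ ^ 2)) := by
    have h0 := fun i => gaussianReal_eq_withDensity (a i) hv
    have : ∀ i, IsProbabilityMeasure ((gaussianReal 0 (σ ^ 2).toNNReal).withDensity fun x =>
        ENNReal.ofReal (Real.exp ((a i * x - a i ^ 2 / 2) / (σ ^ 2).toNNReal))) :=
      fun i => by rw [← h0]; infer_instance
    rw [funext h0, pi_withDensity _ _ (fun i => by fun_prop)]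
    congr 1
    ext x
    rw [← ENNReal.ofReal_prod_of_nonneg (fun _ _ => (Real.exp_pos _).le), ← Real.exp_sum, hv',
      EuclideanSpace.norm_sq_eq, PiLp.inner_apply, ← Finset.sum_div, Finset.sum_sub_distrib,
      Finset.sum_div]
    simp [mul_comm]
  unfold noise
  ext s hs
  rw [Measure.map_map (by fun_prop) (by fun_prop), withDensity_apply _ hs,
    setLIntegral_map hs (by fun_prop) (by fun_prop),
    ← withDensity_apply _ (by exact (WithLp.measurable_toLp 2 _) hs), ← hd, ← hpi,
    Measure.map_apply (by fun_prop) hs,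
    Measure.map_apply (by fun_prop) (by exact (WithLp.measurable_toLp 2 _) hs)]
  rfl

lemma integrable_noise_apply_sq (ℓ : ℕ) (σ : ℝ) (i : Fin ℓ) :
    Integrable (fun z : Euc ℓ => z i ^ 2) (noise ℓ σ) := by
  unfold noise
  rw [integrable_map_measure (by fun_prop) (by fun_prop)]
  have h : Integrable (fun x : ℝ => x ^ 2) (gaussianReal 0 (σ ^ 2).toNNReal) :=
    (memLp_id_gaussianReal 2).integrable_sq
  exact integrable_comp_eval (μ := fun _ : Fin ℓ => gaussianReal 0 (σ ^ 2).toNNReal) (i := i) h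

lemma integral_noise_apply_sq (ℓ : ℕ) (σ : ℝ) (i : Fin ℓ) :
    ∫ z, z i ^ 2 ∂(noise ℓ σ) = σ ^ 2 := by
  unfold noise
  rw [integral_map (by fun_prop) (by fun_prop)]
  have h := integral_comp_eval (μ := fun _ : Fin ℓ => gaussianReal 0 (σ ^ 2).toNNReal) (i := i)
    (f := fun x : ℝ => x ^ 2) (by fun_prop)
  refine h.trans ?_
  have h2 := variance_fun_id_gaussianReal (μ := 0) (v := (σ ^ 2).toNNReal)
  rw [variance_eq_integral (by fun_prop), integral_id_gaussianReal] at h2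
  simpa [Real.coe_toNNReal _ (sq_nonneg σ)] using h2

lemma integrable_noise_apply (ℓ : ℕ) (σ : ℝ) (i : Fin ℓ) :
    Integrable (fun z : Euc ℓ => z i) (noise ℓ σ) := by
  have h : MemLp (fun z : Euc ℓ => z i) 2 (noise ℓ σ) :=
    (memLp_two_iff_integrable_sq (by fun_prop)).2 (integrable_noise_apply_sq ℓ σ i)
  exact h.integrable (by norm_num)

lemma integral_noise_apply (ℓ : ℕ) (σ : ℝ) (i : Fin ℓ) :
    ∫ z, z i ∂(noise ℓ σ) = 0 := by
  unfold noise
  rw [integral_map (by fun_prop) (by fun_prop)]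
  have h := integral_comp_eval (μ := fun _ : Fin ℓ => gaussianReal 0 (σ ^ 2).toNNReal) (i := i)
    (f := fun x : ℝ => x) (by fun_prop)
  refine h.trans ?_
  exact integral_id_gaussianReal

lemma integrable_noise_norm_sq (ℓ : ℕ) (σ : ℝ) :
    Integrable (fun z : Euc ℓ => ‖z‖ ^ 2) (noise ℓ σ) := by
  simp_rw [EuclideanSpace.norm_sq_eq, Real.norm_eq_abs, sq_abs]
  exact integrable_finsetSum _ fun i _ => integrable_noise_apply_sq ℓ σ i

lemma integral_noise_norm_sq (ℓ : ℕ) (σ : ℝ) :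
    ∫ z, ‖z‖ ^ 2 ∂(noise ℓ σ) = ℓ * σ ^ 2 := by
  simp_rw [EuclideanSpace.norm_sq_eq, Real.norm_eq_abs, sq_abs]
  rw [integral_finsetSum _ fun i _ => integrable_noise_apply_sq ℓ σ i]
  simp [integral_noise_apply_sq]

lemma integrable_noise_inner (ℓ : ℕ) (σ : ℝ) (a : Euc ℓ) :
    Integrable (fun z : Euc ℓ => inner ℝ a z) (noise ℓ σ) := by
  simp_rw [PiLp.inner_apply]
  exact integrable_finsetSum _ fun i _ => by
    simpa using (integrable_noise_apply ℓ σ i).mul_const (a i)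

lemma integral_noise_inner (ℓ : ℕ) (σ : ℝ) (a : Euc ℓ) :
    ∫ z, inner ℝ a z ∂(noise ℓ σ) = 0 := by
  simp_rw [PiLp.inner_apply]
  rw [integral_finsetSum _ fun i _ => by
    simpa using (integrable_noise_apply ℓ σ i).mul_const (a i)]
  refine Finset.sum_eq_zero fun i _ => ?_
  simp [integral_mul_const, integral_noise_apply]

/-! ### The law of the transcript -/

section Transcript

variable {d ℓ T : ℕ} {B P : ℝ} {X : Set (Euc d)} {c : Code d ℓ B P}

lemma measurable_observe_map (c : Code d ℓ B P) :
    Measurable fun p : Euc d × c.U × Euc ℓ => (p.2.1, c.enc p.1 p.2.1 + p.2.2) := by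
  have h : Measurable fun p : Euc d × c.U × Euc ℓ => c.enc p.1 p.2.1 :=
    c.measurable_enc.comp (measurable_fst.prodMk (measurable_fst.comp measurable_snd))
  fun_prop

lemma observe_apply (c : Code d ℓ B P) (σ : ℝ) (O : Kernel X (Euc d)) [IsMarkovKernel O] (x : X) :
    observe c σ O x = ((O x).prod (c.lawU.prod (noise ℓ σ))).map
      fun p => (p.2.1, c.enc p.1 p.2.1 + p.2.2) := by
  rw [observe, Kernel.map_apply _ (measurable_observe_map c), Kernel.prod_apply, Kernel.const_apply]

instance isMarkovKernel_observe (c : Code d ℓ B P) (σ : ℝ) (O : Kernel X (Euc d))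
    [IsMarkovKernel O] : IsMarkovKernel (observe c σ O) :=
  Kernel.IsMarkovKernel.map _ (measurable_observe_map c)

lemma measurable_snoc_obs (W Ω : Type*) [MeasurableSpace W] [MeasurableSpace Ω] (t : ℕ) :
    Measurable fun q : (W × (Fin t → Ω)) × Ω =>
      (q.1.1, Fin.snoc (α := fun _ => Ω) q.1.2 q.2) := by
  refine (measurable_fst.comp measurable_fst).prodMk (measurable_pi_iff.2 fun i => ?_)
  refine Fin.lastCases ?_ (fun j => ?_) i
  · simp only [Fin.snoc_last]; exact measurable_snd
  · simp only [Fin.snoc_castSucc]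
    fun_prop

instance isProbabilityMeasure_transcript (σ : ℝ) (π : Algorithm X c T) (O : Kernel X (Euc d))
    [IsMarkovKernel O] : ∀ t, IsProbabilityMeasure (transcript σ π O t)
  | 0 => Measure.isProbabilityMeasure_map (by fun_prop)
  | t + 1 => by
    have := isProbabilityMeasure_transcript σ π O t
    have := Kernel.IsMarkovKernel.comap (observe c σ O) (π.measurable_query t)
    exact Measure.isProbabilityMeasure_map (measurable_snoc_obs π.W (Obs c) t).aemeasurable

/-- Splits off the last observation. Every induction on the number of queries rests on this lemma or
on its Bochner version below, where the bound on `F` supplies integrability. -/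
lemma lintegral_transcript_succ (σ : ℝ) (π : Algorithm X c T) (O : Kernel X (Euc d))
    [IsMarkovKernel O] (t : ℕ) {F : π.W × (Fin (t + 1) → Obs c) → ℝ≥0∞} (hF : Measurable F) :
    ∫⁻ h, F h ∂(transcript σ π O (t + 1)) =
      ∫⁻ q, ∫⁻ o, F (q.1, Fin.snoc (α := fun _ => Obs c) q.2 o) ∂(observe c σ O (π.query t q))
        ∂(transcript σ π O t) := by
  have := Kernel.IsMarkovKernel.comap (observe c σ O) (π.measurable_query t)
  have hs := measurable_snoc_obs π.W (Obs c) t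
  rw [transcript, lintegral_map hF hs]
  exact Measure.lintegral_compProd (hF.comp hs)

lemma integral_transcript_succ (σ : ℝ) (π : Algorithm X c T) (O : Kernel X (Euc d))
    [IsMarkovKernel O] (t : ℕ) {F : π.W × (Fin (t + 1) → Obs c) → ℝ} (hF : Measurable F)
    (C : ℝ) (hC : ∀ h, |F h| ≤ C) :
    ∫ h, F h ∂(transcript σ π O (t + 1)) =
      ∫ q, ∫ o, F (q.1, Fin.snoc (α := fun _ => Obs c) q.2 o) ∂(observe c σ O (π.query t q))
        ∂(transcript σ π O t) := by
  have := Kernel.IsMarkovKernel.comap (observe c σ O) (π.measurable_query t)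
  have hs := measurable_snoc_obs π.W (Obs c) t
  rw [transcript, integral_map hs.aemeasurable hF.aestronglyMeasurable, Measure.integral_compProd]
  · rfl
  · exact Integrable.of_bound (hF.comp hs).aestronglyMeasurable C (ae_of_all _ fun q => hC _)

end Transcript

/-! ### Instances have Lipschitz objectives -/

section Instance

variable {d : ℕ} {B : ℝ} {X : Set (Euc d)} (I : Instance X B)

lemma Instance.integrable_norm_sq (x : X) : Integrable (fun g => ‖g‖ ^ 2) (I.O x) := by
  refine ⟨by fun_prop, ?_⟩
  have h := (I.meanSquare x).trans_lt ENNReal.ofReal_lt_top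
  simpa [hasFiniteIntegral_iff_enorm] using h

lemma Instance.integral_norm_sq_le (x : X) : ∫ g, ‖g‖ ^ 2 ∂(I.O x) ≤ B ^ 2 := by
  rw [integral_eq_lintegral_of_nonneg_ae (ae_of_all _ fun _ => by positivity) (by fun_prop)]
  refine ENNReal.toReal_le_of_le_ofReal (sq_nonneg B) ?_
  refine le_trans (le_of_eq (lintegral_congr fun g => ?_)) (I.meanSquare x)
  rw [ENNReal.ofReal_pow (norm_nonneg _), ofReal_norm]

lemma Instance.integrable_id (x : X) : Integrable (fun g => g) (I.O x) := by
  have h : MemLp (fun g : Euc d => g) 2 (I.O x) :=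
    (memLp_two_iff_integrable_sq_norm (by fun_prop)).2 (I.integrable_norm_sq x)
  exact h.integrable (by norm_num)

/-- From ‖g‖ ≤ 1 + ‖g‖². The constant is crude, but it serves only for measurability and boundedness
and never enters the rate. -/
lemma Instance.norm_integral_le (x : X) : ‖∫ g, g ∂(I.O x)‖ ≤ 1 + B ^ 2 := by
  refine (norm_integral_le_integral_norm _).trans ?_
  have h : ∫ g, ‖g‖ ∂(I.O x) ≤ ∫ g, (1 + ‖g‖ ^ 2) ∂(I.O x) :=
    integral_mono (I.integrable_id x).norm ((integrable_const _).add (I.integrable_norm_sq x))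
      fun g => by nlinarith [sq_nonneg (‖g‖ - 1), norm_nonneg g]
  rw [integral_add (integrable_const _) (I.integrable_norm_sq x)] at h
  simp only [integral_const, probReal_univ, smul_eq_mul, mul_one] at h
  linarith [I.integral_norm_sq_le x]

lemma Instance.sub_le (x y : X) : I.f x - I.f y ≤ (1 + B ^ 2) * ‖(x : Euc d) - y‖ := by
  have h := I.unbiased x y y.2
  have h2 := real_inner_le_norm (∫ g, g ∂(I.O x)) ((x : Euc d) - y)
  have h3 := mul_le_mul_of_nonneg_right (I.norm_integral_le x) (norm_nonneg ((x : Euc d) - y))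
  rw [← neg_sub (x : Euc d) y, inner_neg_right] at h
  linarith

lemma Instance.abs_sub_le (x y : X) : |I.f x - I.f y| ≤ (1 + B ^ 2) * ‖(x : Euc d) - y‖ := by
  rw [abs_sub_le_iff]
  refine ⟨I.sub_le x y, ?_⟩
  rw [norm_sub_rev]
  exact I.sub_le y x

/-- Convexity alone does not control `f` on the boundary of `X`. Subgradients of bounded norm at
every point do: they make `f` Lipschitz on `X`. -/
lemma Instance.measurable_f : Measurable fun x : X => I.f x := by
  have h : LipschitzWith (1 + B ^ 2).toNNReal fun x : X => I.f x := by
    refine LipschitzWith.of_dist_le_mul fun x y => ?_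
    rw [Real.coe_toNNReal _ (by positivity), Real.dist_eq, Subtype.dist_eq, dist_eq_norm]
    exact I.abs_sub_le x y
  exact h.continuous.measurable

/-- The `⨅` in `convError` is a real infimum, so comparing it with a value of `f` requires
boundedness below. -/
lemma Instance.bddBelow_range {D : ℝ} (hX : X ∈ domains d D) :
    BddBelow (Set.range fun x : X => I.f x) := by
  obtain ⟨x₀, hx₀⟩ := hX.1
  refine ⟨I.f x₀ - (1 + B ^ 2) * D, ?_⟩
  rintro _ ⟨x, rfl⟩
  have h := I.sub_le ⟨x₀, hx₀⟩ x
  have h2 := mul_le_mul_of_nonneg_left (hX.2.2 x₀ hx₀ x x.2) (by positivity : 0 ≤ 1 + B ^ 2)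
  simp only at h ⊢
  linarith

end Instance

/-! ### Approximate projections -/

/-- A convex set of bounded diameter, closed or not, has measurable approximate projections. -/
lemma exists_measurable_approx_projection {d : ℕ} {D : ℝ} (hD : 0 < D) {X : Set (Euc d)}
    (hX : X ∈ domains d D) {δ : ℝ} (hδ : 0 < δ) :
    ∃ p : Euc d → X, Measurable p ∧
      ∀ y, ∀ x ∈ X, ‖(p y : Euc d) - x‖ ^ 2 ≤ ‖y - x‖ ^ 2 + δ := by
  classical
  obtain ⟨hne, hconv, hdiam⟩ := hX
  have : Nonempty X := hne.to_subtype
  -- A nearest point need not exist in `X`. The first point of a dense sequence that nearly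
  -- minimises the distance exists and depends measurably on `y`.
  let q := TopologicalSpace.denseSeq X
  have hq : DenseRange q := TopologicalSpace.denseRange_denseSeq X
  -- With this `lam` and ε = lam·δ/2, near-minimality along the segment from z to x gives 2·lam·⟨y −
  -- z, x − z⟩ ≤ ε + lam²D² ≤ lam·δ, an obtuse-angle inequality up to δ.
  obtain ⟨lam, hlam, hlam1, hlamD⟩ : ∃ lam : ℝ, 0 < lam ∧ lam ≤ 1 ∧ lam * D ^ 2 ≤ δ / 2 := by
    refine ⟨min 1 (δ / (2 * D ^ 2)), by positivity, min_le_left _ _, ?_⟩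
    refine (mul_le_mul_of_nonneg_right (min_le_right _ _) (sq_nonneg D)).trans (le_of_eq ?_)
    field_simp
  set ε := lam * δ / 2 with hε
  have hεpos : 0 < ε := by positivity
  have hex : ∀ y : Euc d, ∃ n, ‖y - q n‖ ^ 2 < Metric.infDist y X ^ 2 + ε := by
    intro y
    have h1 : Metric.infDist y X < √(Metric.infDist y X ^ 2 + ε) := by
      apply Real.lt_sqrt_of_sq_lt; linarith
    obtain ⟨x, hx, hxy⟩ := (Metric.infDist_lt_iff hne).1 h1
    have hopen : IsOpen {z : X | dist y (z : Euc d) < √(Metric.infDist y X ^ 2 + ε)} :=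
      isOpen_lt (by fun_prop) (by fun_prop)
    obtain ⟨n, hn⟩ := hq.exists_mem_open hopen ⟨⟨x, hx⟩, hxy⟩
    refine ⟨n, ?_⟩
    have hn' : ‖y - q n‖ < √(Metric.infDist y X ^ 2 + ε) := by
      rw [← dist_eq_norm]; exact hn
    have h2 := Real.sq_sqrt (by positivity : 0 ≤ Metric.infDist y X ^ 2 + ε)
    rw [← h2]
    gcongr
  refine ⟨fun y => q (Nat.find (hex y)), ?_, ?_⟩
  · refine Measurable.find (f := fun n _ => q n) (fun n => measurable_const) (fun n => ?_) hex
    exact measurableSet_lt (by fun_prop)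
      (((Metric.continuous_infDist_pt X).measurable.pow_const 2).add_const ε)
  · intro y x hx
    have hn := Nat.find_spec (hex y)
    set z : Euc d := (q (Nat.find (hex y)) : Euc d) with hz
    have hzX : z ∈ X := Subtype.coe_prop _
    have hm : z + lam • (x - z) ∈ X := hconv.add_smul_sub_mem hzX hx ⟨hlam.le, hlam1⟩
    have h1 : Metric.infDist y X ^ 2 ≤ ‖y - (z + lam • (x - z))‖ ^ 2 := by
      have := Metric.infDist_le_dist_of_mem (x := y) hm
      rw [dist_eq_norm] at this
      have h0 := Metric.infDist_nonneg (x := y) (s := X)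
      gcongr
    have h2 : ‖y - (z + lam • (x - z))‖ ^ 2 =
        ‖y - z‖ ^ 2 - 2 * lam * inner ℝ (y - z) (x - z) + lam ^ 2 * ‖x - z‖ ^ 2 := by
      rw [← sub_sub, norm_sub_sq_real, inner_smul_right, norm_smul, mul_pow, Real.norm_eq_abs,
        sq_abs]
      ring
    have h3 : ‖x - z‖ ^ 2 ≤ D ^ 2 := by gcongr; exact hdiam x hx z hzX
    have h4 : ‖y - x‖ ^ 2 = ‖y - z‖ ^ 2 - 2 * inner ℝ (y - z) (x - z) + ‖z - x‖ ^ 2 := by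
      rw [norm_sub_rev z x, ← norm_sub_sq_real]
      congr 2; abel
    have h5 : lam * (2 * inner ℝ (y - z) (x - z)) ≤ lam * δ := by
      have := mul_le_mul_of_nonneg_left h3 (sq_nonneg lam)
      have := mul_le_mul_of_nonneg_left hlamD hlam.le
      nlinarith
    have h6 := le_of_mul_le_mul_left h5 hlam
    nlinarith [sq_nonneg ‖y - z‖]

/-! ### Stochastic gradient descent with scaled transmission -/

/-- Scaled transmission as a deterministic code. -/
def scaledCode (d : ℕ) (B P : ℝ) (hB : 0 < B) (hP : 0 < P) : Code d d B P where
  U := Unit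
  mU := inferInstance
  lawU := Measure.dirac ()
  probU := inferInstance
  enc g _ := (√(P * d) / B) • g
  measurable_enc := by
    change Measurable fun p : Euc d × Unit => (√(P * d) / B) • p.1
    fun_prop
  power ν _ hν := by
    have h1 : ∀ g : Euc d, ‖(√(P * d) / B) • g‖ₑ ^ 2 = ENNReal.ofReal (P * d / B ^ 2) * ‖g‖ₑ ^ 2 := by
      intro g
      rw [enorm_smul, mul_pow, Real.enorm_eq_ofReal (by positivity),
        ← ENNReal.ofReal_pow (by positivity), div_pow, Real.sq_sqrt (by positivity)]
    simp only [lintegral_const, measure_univ, mul_one, h1]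
    rw [lintegral_const_mul _ (by fun_prop)]
    refine (mul_le_mul_right hν _).trans (le_of_eq ?_)
    rw [← ENNReal.ofReal_mul (by positivity)]
    congr 1
    field_simp

section SGD

variable {d : ℕ} {X : Set (Euc d)} {U : Type}

/-- One step of projected stochastic gradient descent on pairs of a running average and an iterate;
`p` is the projection and `y` the scaled gradient estimate. -/
def sgdStep (hX : Convex ℝ X) (p : Euc d → X) (r : ℝ) (t : ℕ) (s : X × X) (y : Euc d) : X × X :=
  (⟨((t : ℝ) / (t + 1)) • (s.1 : Euc d) + (1 / ((t : ℝ) + 1)) • (s.2 : Euc d),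
    hX s.1.2 s.2.2 (by positivity) (by positivity) (by field_simp)⟩, p (s.2 - r • y))

lemma measurable_sgdStep (hX : Convex ℝ X) {p : Euc d → X} (hp : Measurable p) (r : ℝ) (t : ℕ) :
    Measurable fun q : (X × X) × Euc d => sgdStep hX p r t q.1 q.2 := by
  refine Measurable.prodMk (Measurable.subtype_mk (by fun_prop)) (hp.comp (by fun_prop))

/-- The running average and the iterate after `t` observations. -/
def sgdState (hX : Convex ℝ X) (p : Euc d → X) (r : ℝ) (x₀ : X) :
    (t : ℕ) → (Fin t → U × Euc d) → X × X
  -- The initial value of the average is irrelevant: the first step gives it weight 0/(0+1).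
  | 0, _ => (x₀, x₀)
  | t + 1, h => sgdStep hX p r t (sgdState hX p r x₀ t fun i => h i.castSucc) (h (Fin.last t)).2

lemma measurable_sgdState [MeasurableSpace U] (hX : Convex ℝ X) {p : Euc d → X} (hp : Measurable p) (r : ℝ) (x₀ : X) :
    ∀ t, Measurable (sgdState (U := U) hX p r x₀ t)
  | 0 => measurable_const
  | t + 1 => by
    have ih := measurable_sgdState hX hp r x₀ t
    have h1 : Measurable fun h : Fin (t + 1) → U × Euc d => fun i : Fin t => h i.castSucc := by
      fun_prop
    exact (measurable_sgdStep hX hp r t).comp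
      ((ih.comp h1).prodMk (measurable_snd.comp (measurable_pi_apply _)))

lemma sgdState_snoc (hX : Convex ℝ X) (p : Euc d → X) (r : ℝ) (x₀ : X) (t : ℕ)
    (h : Fin t → U × Euc d) (o : U × Euc d) :
    sgdState hX p r x₀ (t + 1) (Fin.snoc (α := fun _ => U × Euc d) h o) =
      sgdStep hX p r t (sgdState hX p r x₀ t h) o.2 := by
  simp [sgdState]

/-- Projected stochastic gradient descent over the channel, with output the average of the
iterates. -/
def sgdAlgorithm {B P : ℝ} (hB : 0 < B) (hP : 0 < P) (hX : Convex ℝ X) {p : Euc d → X}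
    (hp : Measurable p) (r : ℝ) (x₀ : X) (T : ℕ) : Algorithm X (scaledCode d B P hB hP) T where
  W := Unit
  mW := inferInstance
  lawW := Measure.dirac ()
  probW := inferInstance
  query t h := (sgdState hX p r x₀ t h.2).2
  measurable_query t := measurable_snd.comp ((measurable_sgdState hX hp r x₀ t).comp measurable_snd)
  output h := (sgdState hX p r x₀ T h.2).1
  measurable_output := measurable_fst.comp ((measurable_sgdState hX hp r x₀ T).comp measurable_snd)

/-- The expected decrease of the squared distance to a point of `X` in one step. -/
lemma integral_observe_scaledCode_le {B P σ : ℝ} (hd : 1 ≤ d) (hB : 0 < B) (hP : 0 < P) (I : Instance X B) {c : Code d d B P}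
    (hc : ∀ g u, c.enc g u = (√(P * d) / B) • g) {p : Euc d → X} (hp : Measurable p) {δ : ℝ}
    (hpδ : ∀ y, ∀ x ∈ X, ‖(p y : Euc d) - x‖ ^ 2 ≤ ‖y - x‖ ^ 2 + δ) {η : ℝ} (hη : 0 ≤ η) (x y : X) :
    ∫ o, ‖(p ((x : Euc d) - (η * (B / √(P * d))) • o.2) : Euc d) - y‖ ^ 2
        ∂(observe c σ I.O x) ≤
      ‖(x : Euc d) - y‖ ^ 2 - 2 * η * (I.f x - I.f y) + η ^ 2 * (B ^ 2 + B ^ 2 * σ ^ 2 / P) + δ := by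
  have hd' : (0 : ℝ) < d := by exact_mod_cast hd
  -- κ undoes the gain of the code, so κ times the channel output is g + κz. The noise then
  -- contributes κ²·dσ² = B²σ²/P, in which d has cancelled.
  set κ := B / √(P * d) with hκ
  have hs : 0 < √(P * d) := by positivity
  have hκ2 : κ ^ 2 = B ^ 2 / (P * d) := by rw [hκ, div_pow, Real.sq_sqrt (by positivity)]
  set a : Euc d := (x : Euc d) - y with ha
  rw [observe_apply, integral_map (measurable_observe_map _).aemeasurable
    (Measurable.aestronglyMeasurable (by fun_prop))]
  set ν := (I.O x).prod (c.lawU.prod (noise d σ)) with hν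
  have hmpz : MeasurePreserving (fun q : Euc d × c.U × Euc d => q.2.2) ν (noise d σ) :=
    measurePreserving_snd.comp measurePreserving_snd
  have hmpg : MeasurePreserving (fun q : Euc d × c.U × Euc d => q.1) ν (I.O x) :=
    measurePreserving_fst
  have ig : Integrable (fun q : Euc d × c.U × Euc d => inner ℝ a q.1) ν :=
    hmpg.integrable_comp_of_integrable ((I.integrable_id x).const_inner a)
  have ig2 : Integrable (fun q : Euc d × c.U × Euc d => ‖q.1‖ ^ 2) ν :=
    hmpg.integrable_comp_of_integrable (I.integrable_norm_sq x)
  have iz : Integrable (fun q : Euc d × c.U × Euc d => inner ℝ a q.2.2) ν :=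
    hmpz.integrable_comp_of_integrable (integrable_noise_inner d σ a)
  have iz2 : Integrable (fun q : Euc d × c.U × Euc d => ‖q.2.2‖ ^ 2) ν :=
    hmpz.integrable_comp_of_integrable (integrable_noise_norm_sq d σ)
  have igz : Integrable (fun q : Euc d × c.U × Euc d => inner ℝ q.1 q.2.2) ν := by
    refine (ig2.add iz2).mono' (by fun_prop) (ae_of_all _ fun q => ?_)
    have h1 := norm_inner_le_norm (𝕜 := ℝ) q.1 q.2.2
    simp only [Pi.add_apply]
    nlinarith [sq_nonneg (‖q.1‖ - ‖q.2.2‖), sq_nonneg ‖q.1‖, sq_nonneg ‖q.2.2‖]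
  have eg : ∫ q, inner ℝ a q.1 ∂ν = inner ℝ a (∫ g, g ∂(I.O x)) := by
    rw [← integral_inner (I.integrable_id x),
      ← integral_map hmpg.aemeasurable (f := fun g => inner ℝ a g) (by fun_prop), hmpg.map_eq]
  have eg2 : ∫ q, ‖q.1‖ ^ 2 ∂ν ≤ B ^ 2 := by
    rw [← integral_map hmpg.aemeasurable (f := fun g => ‖g‖ ^ 2) (by fun_prop), hmpg.map_eq]
    exact I.integral_norm_sq_le x
  have ez : ∫ q, inner ℝ a q.2.2 ∂ν = 0 := by
    rw [← integral_map hmpz.aemeasurable (f := fun g => inner ℝ a g) (by fun_prop), hmpz.map_eq]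
    exact integral_noise_inner d σ a
  have ez2 : ∫ q, ‖q.2.2‖ ^ 2 ∂ν = d * σ ^ 2 := by
    rw [← integral_map hmpz.aemeasurable (f := fun g => ‖g‖ ^ 2) (by fun_prop), hmpz.map_eq]
    exact integral_noise_norm_sq d σ
  have egz : ∫ q, inner ℝ q.1 q.2.2 ∂ν = 0 := by
    rw [hν, integral_prod _ igz]
    have : ∀ g : Euc d, ∫ z, inner ℝ g z.2 ∂(c.lawU.prod (noise d σ)) = 0 := by
      intro g
      rw [← integral_map (φ := Prod.snd) (by fun_prop) (f := fun z => inner ℝ g z) (by fun_prop),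
        (measurePreserving_snd (μ := c.lawU) (ν := noise d σ)).map_eq]
      exact integral_noise_inner d σ g
    simp [this]
  -- The projection costs δ; the rest expands ‖a − η(g + κz)‖², where both terms linear in z have
  -- mean zero.
  have hpt : ∀ q : Euc d × c.U × Euc d,
      ‖(p ((x : Euc d) - (η * κ) • (c.enc q.1 q.2.1 + q.2.2)) : Euc d) - y‖ ^ 2
      ≤ (((((‖a‖ ^ 2 + δ) + (-2 * η) * inner ℝ a q.1) + (-2 * η * κ) * inner ℝ a q.2.2) +
        η ^ 2 * ‖q.1‖ ^ 2) + (2 * η ^ 2 * κ) * inner ℝ q.1 q.2.2) +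
        (η ^ 2 * κ ^ 2) * ‖q.2.2‖ ^ 2 := by
    rintro ⟨g, u, z⟩
    refine (hpδ _ y y.2).trans (le_of_eq ?_)
    have h1 : (η * κ) • (c.enc g u + z) = η • (g + κ • z) := by
      rw [hc, smul_add, smul_smul, smul_add, smul_smul]
      congr 2
      rw [hκ]; field_simp
    have h2 : (x : Euc d) - η • (g + κ • z) - y = a - η • (g + κ • z) := by rw [ha]; abel
    simp only [h1, h2]
    rw [norm_sub_sq_real, inner_smul_right, inner_add_right, inner_smul_right, norm_smul, mul_pow,
      norm_add_sq_real, inner_smul_right, norm_smul, mul_pow, Real.norm_eq_abs, Real.norm_eq_abs,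
      sq_abs, sq_abs]
    ring
  have j1 := (integrable_const (μ := ν) (‖a‖ ^ 2 + δ)).add (ig.const_mul (-2 * η))
  have j2 := j1.add (iz.const_mul (-2 * η * κ))
  have j3 := j2.add (ig2.const_mul (η ^ 2))
  have j4 := j3.add (igz.const_mul (2 * η ^ 2 * κ))
  have j5 := j4.add (iz2.const_mul (η ^ 2 * κ ^ 2))
  refine (integral_mono_of_nonneg (ae_of_all _ fun _ => by positivity) j5
    (ae_of_all _ hpt)).trans ?_
  rw [integral_add' j4 (iz2.const_mul _), integral_add' j3 (igz.const_mul _),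
    integral_add' j2 (ig2.const_mul _), integral_add' j1 (iz.const_mul _),
    integral_add' (integrable_const _) (ig.const_mul _)]
  simp only [integral_const_mul, integral_const, probReal_univ, smul_eq_mul, one_mul,
    eg, ez, ez2, egz]
  have hsub := I.unbiased x y y.2
  rw [← neg_sub (x : Euc d) y, inner_neg_right, real_inner_comm, ← ha] at hsub
  have h7 : κ ^ 2 * (d * σ ^ 2) = B ^ 2 * σ ^ 2 / P := by rw [hκ2]; field_simp
  have h8 := mul_le_mul_of_nonneg_left hsub (by positivity : 0 ≤ 2 * η)
  have h9 := mul_le_mul_of_nonneg_left eg2 (sq_nonneg η)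
  rw [mul_assoc (η ^ 2), h7]
  nlinarith

/-- The potential argument: expected error of the average plus squared distance of the iterate. -/
lemma integral_potential_le {B P σ D : ℝ} (hd : 1 ≤ d) (hB : 0 < B) (hP : 0 < P)
    (hXD : X ∈ domains d D) (I : Instance X B) {c : Code d d B P}
    (hc : ∀ g u, c.enc g u = (√(P * d) / B) • g) {p : Euc d → X} (hp : Measurable p) {δ : ℝ}
    (hpδ : ∀ y, ∀ x ∈ X, ‖(p y : Euc d) - x‖ ^ 2 ≤ ‖y - x‖ ^ 2 + δ) {η : ℝ} (hη : 0 ≤ η)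
    (x₀ y : X) {T : ℕ} (π : Algorithm X c T)
    (hπ : ∀ t q, π.query t q = (sgdState hXD.2.1 p (η * (B / √(P * d))) x₀ t q.2).2) (t : ℕ) :
    ∫ h, (2 * η * t * (I.f (sgdState hXD.2.1 p (η * (B / √(P * d))) x₀ t h.2).1 - I.f y) +
      ‖((sgdState hXD.2.1 p (η * (B / √(P * d))) x₀ t h.2).2 : Euc d) - y‖ ^ 2)
      ∂(transcript σ π I.O t) ≤
    D ^ 2 + t * (η ^ 2 * (B ^ 2 + B ^ 2 * σ ^ 2 / P) + δ) := by
  set r := η * (B / √(P * d)) with hr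
  set V := B ^ 2 + B ^ 2 * σ ^ 2 / P with hV
  have hfD : ∀ a b : X, |I.f a - I.f b| ≤ (1 + B ^ 2) * D := fun a b =>
    (I.abs_sub_le a b).trans
      (mul_le_mul_of_nonneg_left (hXD.2.2 a a.2 b b.2) (by positivity))
  have hnD : ∀ a b : X, ‖(a : Euc d) - b‖ ^ 2 ≤ D ^ 2 := fun a b => by
    have := hXD.2.2 a a.2 b b.2
    gcongr
  -- By convexity of `f`, updating the average raises the first term by at most 2η(f(xₜ) − f(y)).
  -- The expected change of the squared distance contains the opposite of this, so Φ grows by at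
  -- most η²V + δ per step.
  let Φ : ℕ → X × X → ℝ := fun t s => 2 * η * t * (I.f s.1 - I.f y) + ‖(s.2 : Euc d) - y‖ ^ 2
  have hΦm : ∀ t, Measurable (Φ t) := fun t =>
    (((I.measurable_f.comp measurable_fst).sub_const _).const_mul _).add
      (by fun_prop)
  have hΦb : ∀ t s, |Φ t s| ≤ 2 * η * t * ((1 + B ^ 2) * D) + D ^ 2 := fun t s => by
    refine (abs_add_le _ _).trans (add_le_add ?_ ?_)
    · rw [abs_mul, abs_of_nonneg (by positivity)]
      exact mul_le_mul_of_nonneg_left (hfD _ _) (by positivity)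
    · rw [abs_of_nonneg (by positivity)]; exact hnD _ _
  have hsm : ∀ t, Measurable fun h : π.W × (Fin t → Obs c) =>
      sgdState hXD.2.1 p r x₀ t h.2 := fun t =>
    (measurable_sgdState hXD.2.1 hp r x₀ t).comp measurable_snd
  induction t with
  | zero =>
    have : ∀ h : π.W × (Fin 0 → Obs c), Φ 0 (sgdState hXD.2.1 p r x₀ 0 h.2) ≤ D ^ 2 := by
      intro h
      refine (le_abs_self _).trans ((hΦb 0 _).trans (by simp))
    have h2 := integral_mono (μ := transcript σ π I.O 0)
      (f := fun h => Φ 0 (sgdState hXD.2.1 p r x₀ 0 h.2)) (Integrable.of_bound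
      ((hΦm 0).comp (hsm 0)).aestronglyMeasurable _ (ae_of_all _ fun h => hΦb 0 _))
      (integrable_const (D ^ 2)) this
    simp only [integral_const, probReal_univ, smul_eq_mul, one_mul] at h2
    simpa [Φ] using h2
  | succ t ih =>
    have key := integral_transcript_succ σ π I.O t
      (F := fun h => Φ (t + 1) (sgdState hXD.2.1 p r x₀ (t + 1) h.2))
      ((hΦm _).comp (hsm _)) _ (fun h => hΦb _ _)
    have hstep : ∀ q : π.W × (Fin t → Obs c),
        ∫ o, Φ (t + 1) (sgdState hXD.2.1 p r x₀ (t + 1)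
          (Fin.snoc (α := fun _ => Obs c) q.2 o))
          ∂(observe c σ I.O (π.query t q)) ≤
        Φ t (sgdState hXD.2.1 p r x₀ t q.2) + (η ^ 2 * V + δ) := by
      intro q
      simp only [sgdState_snoc]
      rw [hπ]
      generalize sgdState hXD.2.1 p r x₀ t q.2 = s
      have h1 := integral_observe_scaledCode_le (σ := σ) hd hB hP I hc hp hpδ hη s.2 y
      rw [← hr] at h1
      have hpt : ∀ o : Obs c, Φ (t + 1) (sgdStep hXD.2.1 p r t s o.2) ≤
          (2 * η * t * (I.f s.1 - I.f y) + 2 * η * (I.f s.2 - I.f y)) +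
            ‖(p ((s.2 : Euc d) - r • o.2) : Euc d) - y‖ ^ 2 := by
        intro o
        have hc := I.convex.2 s.1.2 s.2.2 (by positivity : 0 ≤ (t : ℝ) / (t + 1))
          (by positivity : 0 ≤ 1 / ((t : ℝ) + 1)) (by field_simp)
        have hc2 := mul_le_mul_of_nonneg_left hc (by positivity : 0 ≤ 2 * η * ((t : ℝ) + 1))
        simp only [smul_eq_mul] at hc2
        have e : 2 * η * ((t : ℝ) + 1) *
            ((t : ℝ) / (t + 1) * I.f s.1 + 1 / ((t : ℝ) + 1) * I.f s.2) =
            2 * η * t * I.f s.1 + 2 * η * I.f s.2 := by field_simp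
        rw [e] at hc2
        simp only [Φ, sgdStep]
        push_cast
        linarith
      have hm1 : Measurable fun o : Obs c => ‖(p ((s.2 : Euc d) - r • o.2) : Euc d) - y‖ ^ 2 := by
        fun_prop
      have i1 : Integrable (fun o : Obs c => ‖(p ((s.2 : Euc d) - r • o.2) : Euc d) - y‖ ^ 2)
          (observe c σ I.O s.2) :=
        Integrable.of_bound hm1.aestronglyMeasurable (D ^ 2) (ae_of_all _ fun o => by
          rw [Real.norm_of_nonneg (by positivity)]; exact hnD _ _)
      have i0 : Integrable (fun o : Obs c => Φ (t + 1) (sgdStep hXD.2.1 p r t s o.2))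
          (observe c σ I.O s.2) :=
        Integrable.of_bound ((hΦm _).comp ((measurable_sgdStep hXD.2.1 hp r t).comp
          (measurable_const.prodMk measurable_snd))).aestronglyMeasurable _
          (ae_of_all _ fun o => hΦb _ _)
      have h2 := integral_mono i0 ((integrable_const _).add i1) hpt
      rw [integral_add' (integrable_const _) i1] at h2
      simp only [integral_const, probReal_univ, smul_eq_mul, one_mul] at h2
      refine h2.trans ?_
      simp only [Φ]
      linarith
    have hfin : ∫ h, Φ (t + 1) (sgdState hXD.2.1 p r x₀ (t + 1) h.2) ∂(transcript σ π I.O (t + 1)) ≤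
        ∫ q, (Φ t (sgdState hXD.2.1 p r x₀ t q.2) + (η ^ 2 * V + δ)) ∂(transcript σ π I.O t) := by
      rw [key]
      have i2 : Integrable (fun q : π.W × (Fin t → Obs c) =>
          Φ t (sgdState hXD.2.1 p r x₀ t q.2)) (transcript σ π I.O t) :=
        Integrable.of_bound ((hΦm _).comp (hsm t)).aestronglyMeasurable _
          (ae_of_all _ fun o => hΦb _ _)
      refine integral_mono ?_ (i2.add (integrable_const _)) hstep
      have hk : IsMarkovKernel ((observe c σ I.O).comap (π.query t)
        (π.measurable_query t)) := Kernel.IsMarkovKernel.comap _ _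
      refine Integrable.of_bound (StronglyMeasurable.aestronglyMeasurable ?_)
        (2 * η * (t + 1 : ℕ) * ((1 + B ^ 2) * D) + D ^ 2) (ae_of_all _ fun q => ?_)
      · exact StronglyMeasurable.integral_kernel_prod_right'
          (κ := (observe c σ I.O).comap (π.query t) (π.measurable_query t))
          (((hΦm _).comp (hsm _)).comp
            (measurable_snoc_obs π.W (Obs c) t)).stronglyMeasurable
      · refine (norm_integral_le_of_norm_le_const (ae_of_all _ fun o => hΦb _ _)).trans ?_
        simp
    refine hfin.trans ?_
    rw [integral_add _ (integrable_const _)]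
    · simp only [integral_const, probReal_univ, smul_eq_mul, one_mul]
      push_cast
      have : ∫ q, Φ t (sgdState hXD.2.1 p r x₀ t q.2) ∂(transcript σ π I.O t) ≤ _ := ih
      linarith
    · exact Integrable.of_bound ((hΦm _).comp (hsm t)).aestronglyMeasurable _
          (ae_of_all _ fun o => hΦb _ _)

end SGD

lemma scaledCode_mem_scaledTransmission (d : ℕ) (B P : ℝ) (hB : 0 < B) (hP : 0 < P) :
    scaledCode d B P hB hP ∈ scaledTransmission d B P d :=
  ⟨rfl, fun g _ i => by simp [scaledCode]⟩

/-- The error of stochastic gradient descent with scaled transmission. -/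
lemma convError_sgdAlgorithm_le {d : ℕ} {X : Set (Euc d)} {B P σ D : ℝ} (hd : 1 ≤ d) (hB : 0 < B)
    (hP : 0 < P) (hXD : X ∈ domains d D) (I : Instance X B) {p : Euc d → X}
    (hp : Measurable p) {δ : ℝ}
    (hpδ : ∀ y, ∀ x ∈ X, ‖(p y : Euc d) - x‖ ^ 2 ≤ ‖y - x‖ ^ 2 + δ) {η : ℝ} (hη : 0 < η) (x₀ : X)
    {T : ℕ} (hT : 1 ≤ T) :
    convError σ (sgdAlgorithm hB hP hXD.2.1 hp (η * (B / √(P * d))) x₀ T) I ≤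
      (D ^ 2 + T * (η ^ 2 * (B ^ 2 + B ^ 2 * σ ^ 2 / P) + δ)) / (2 * η * T) := by
  set π := sgdAlgorithm hB hP hXD.2.1 hp (η * (B / √(P * d))) x₀ T with hπ
  set V := B ^ 2 + B ^ 2 * σ ^ 2 / P
  have hT' : (0 : ℝ) < T := by exact_mod_cast hT
  have hne : Nonempty X := ⟨x₀⟩
  have hm : Measurable fun h => I.f (π.output h) := I.measurable_f.comp π.measurable_output
  have hi : Integrable (fun h => I.f (π.output h)) (transcript σ π I.O T) := by
    refine Integrable.of_bound hm.aestronglyMeasurable (|I.f x₀| + (1 + B ^ 2) * D)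
      (ae_of_all _ fun h => ?_)
    have h1 := (I.abs_sub_le (π.output h) x₀).trans
      (mul_le_mul_of_nonneg_left (hXD.2.2 _ (π.output h).2 x₀ x₀.2) (by positivity))
    have h2 := abs_add_le (I.f x₀) (I.f (π.output h) - I.f x₀)
    rw [add_sub_cancel] at h2
    rw [Real.norm_eq_abs]
    linarith
  -- The comparison is with every point of `X`, since the infimum need not be attained.
  have key : ∀ y : X, ∫ h, I.f (π.output h) ∂(transcript σ π I.O T) - I.f y ≤
      (D ^ 2 + T * (η ^ 2 * V + δ)) / (2 * η * T) := by
    intro y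
    have h1 := integral_potential_le (σ := σ) hd hB hP hXD I (c := scaledCode d B P hB hP)
      (fun _ _ => rfl) hp hpδ hη.le x₀ y π (fun _ _ => rfl) T
    have h2 : ∫ h, 2 * η * T * (I.f (π.output h) - I.f y) ∂(transcript σ π I.O T) ≤
        D ^ 2 + T * (η ^ 2 * V + δ) := by
      refine le_trans (integral_mono ((hi.sub (integrable_const _)).const_mul _) ?_ ?_) h1
      · refine ((hi.sub (integrable_const _)).const_mul _).add
          (Integrable.of_bound (Measurable.aestronglyMeasurable ?_) (D ^ 2)
            (ae_of_all _ fun h => ?_))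
        · have := (measurable_sgdState (U := (scaledCode d B P hB hP).U) hXD.2.1 hp
            (η * (B / √(P * d))) x₀ T).comp
            (@measurable_snd π.W _ π.mW _)
          exact (((measurable_subtype_coe.comp (measurable_snd.comp this)).sub_const _).norm).pow_const 2
        · rw [Real.norm_of_nonneg (by positivity)]
          have := hXD.2.2 _ (Subtype.coe_prop
            (sgdState hXD.2.1 p (η * (B / √(P * d))) x₀ T h.2).2) y y.2
          gcongr
      · intro h
        exact le_add_of_nonneg_right (by positivity)
    rw [integral_const_mul, integral_sub hi (integrable_const _)] at h2
    simp only [integral_const, probReal_univ, smul_eq_mul, one_mul] at h2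
    rw [le_div_iff₀ (by positivity)]
    linarith
  unfold convError
  have h3 := le_ciInf (f := fun x : X => I.f x)
    (c := ∫ h, I.f (π.output h) ∂(transcript σ π I.O T) -
      (D ^ 2 + T * (η ^ 2 * V + δ)) / (2 * η * T)) fun y => by linarith [key y]
  linarith

/-- log(1+s) ≤ s and log 2 > 1/2. -/
lemma half_logb_le {s : ℝ} (hs : 0 < s) : Real.logb 2 (1 + s) / 2 ≤ s := by
  have h1 : Real.log (1 + s) ≤ s := by
    have := Real.log_le_sub_one_of_pos (by positivity : 0 < 1 + s); linarith
  have h2 : (1 : ℝ) / 2 < Real.log 2 := by have := Real.log_two_gt_d9; linarith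
  have h3 : Real.log (1 + s) = Real.logb 2 (1 + s) * Real.log 2 := by
    rw [Real.logb]; field_simp
  have h4 : 0 < Real.logb 2 (1 + s) := Real.logb_pos (by norm_num) (by linarith)
  nlinarith

/-- Bernoulli's inequality for an exponent in (0,1): 2ˢ = (1+1)ˢ ≤ 1 + s. -/
lemma le_logb {s : ℝ} (hs : 0 < s) (hs1 : s < 1) : s ≤ Real.logb 2 (1 + s) := by
  rw [Real.le_logb_iff_rpow_le (by norm_num) (by linarith)]
  have h2 := rpow_one_add_le_one_add_mul_self (s := (1 : ℝ)) (by norm_num) hs.le hs1.le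
  norm_num at h2
  exact h2

/-- Scaled transmission attains the order of the min-max error on every domain. -/
lemma minimaxErrorOn_scaledTransmission_le {d N : ℕ} {D B P σ SNR : ℝ} (hd : 1 ≤ d) (hD : 0 < D)
    (hB : 0 < B) (hP : 0 < P) (hσ : 0 < σ) (hS : SNR = P / σ ^ 2) (hS1 : SNR ∈ Set.Ioo (0 : ℝ) 1)
    (hN : (d : ℝ) / Real.logb 2 (1 + SNR) ≤ (N : ℝ)) {X : Set (Euc d)} (hX : X ∈ domains d D) :
    minimaxErrorOn (scaledTransmission d B P) σ N X ≤
      ((5 * (D * B / √N * √(d / Real.logb 2 (1 + SNR))) : ℝ) : EReal) := by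
  obtain ⟨hs0, hs1⟩ := hS1
  set C := Real.logb 2 (1 + SNR) with hC
  have hd' : (0 : ℝ) < d := by exact_mod_cast hd
  have hC0 : 0 < C := Real.logb_pos (by norm_num) (by linarith)
  have hC1 : C ≤ 1 := by
    rw [hC, Real.logb_le_iff_le_rpow (by norm_num) (by linarith)]; norm_num; linarith
  have hCs : C / 2 ≤ SNR := half_logb_le hs0
  have hdN : (d : ℝ) ≤ N := le_trans (by rw [le_div_iff₀ hC0]; nlinarith) hN
  have hdN' : d ≤ N := by exact_mod_cast hdN
  have hN0 : (0 : ℝ) < N := by linarith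
  set T := N / d with hT
  have hT1 : 1 ≤ T := (Nat.one_le_div_iff (by omega)).2 hdN'
  have hT0 : (0 : ℝ) < T := by exact_mod_cast hT1
  -- Rounding N/d down loses at most a factor 2 because T ≥ 1.
  have hT2 : (N : ℝ) ≤ 2 * d * T := by
    have h1 : N < d * (T + 1) := Nat.lt_mul_div_succ N (by omega)
    have h2 : (N : ℝ) < d * (T + 1) := by exact_mod_cast h1
    have h3 : (1 : ℝ) ≤ T := by exact_mod_cast hT1
    nlinarith
  have hdT : d * T ≤ N := Nat.mul_div_le N d
  set V := B ^ 2 + B ^ 2 * σ ^ 2 / P with hV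
  have hVpos : 0 < V := by positivity
  have hVle : V ≤ 2 * B ^ 2 / SNR := by
    have e : V = B ^ 2 * (SNR + 1) / SNR := by rw [hV, hS]; field_simp
    rw [e]
    refine div_le_div_of_nonneg_right ?_ hs0.le
    nlinarith [sq_nonneg B]
  set S := √(V / T) with hSdef
  have hSpos : 0 < S := by positivity
  have hS2 : S ^ 2 = V / T := Real.sq_sqrt (by positivity)
  -- The estimates give S² ≤ 8B²d/(NC), and 8 ≤ (10/3)²; the value 10/3 turns the final (3/2)·D·S
  -- into the constant 5.
  have hSle : S ≤ 10 / 3 * (B / √N * √(d / C)) := by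
    refine Real.sqrt_le_iff.2 ⟨by positivity, ?_⟩
    rw [mul_pow, mul_pow, div_pow B, Real.sq_sqrt hN0.le, Real.sq_sqrt (by positivity)]
    have h1 : V / T ≤ (2 * B ^ 2 / (C / 2)) / (N / (2 * d)) := by
      refine div_le_div₀ (by positivity) (hVle.trans ?_) (by positivity) ?_
      · gcongr
      · rw [div_le_iff₀ (by positivity)]; linarith
    refine h1.trans ?_
    have e : (2 * B ^ 2 / (C / 2)) / ((N : ℝ) / (2 * d)) = 8 * (B ^ 2 / N * (d / C)) := by
      field_simp; norm_num
    rw [e]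
    have : 0 ≤ B ^ 2 / N * (d / C) := by positivity
    nlinarith
  -- The slack D²/T adds up to D² over T steps, and the step size η below makes T·η²V = D² as well.
  -- The numerator of the error bound is therefore 3D².
  obtain ⟨p, hp, hpδ⟩ := exists_measurable_approx_projection hD hX (by positivity : 0 < D ^ 2 / T)
  obtain ⟨x₀, hx₀⟩ := hX.1
  set η := D / (T * S) with hη
  have hηpos : 0 < η := by positivity
  refine (iInf₂_le_of_le d hd <| iInf₂_le_of_le T hdT <| iInf₂_le_of_le (scaledCode d B P hB hP)
    (scaledCode_mem_scaledTransmission d B P hB hP) <|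
    iInf_le_of_le (sgdAlgorithm hB hP hX.2.1 hp (η * (B / √(P * d))) ⟨x₀, hx₀⟩ T) le_rfl).trans ?_
  refine iSup_le fun I => EReal.coe_le_coe_iff.2 ?_
  refine (convError_sgdAlgorithm_le hd hB hP hX I hp hpδ hηpos ⟨x₀, hx₀⟩ hT1).trans ?_
  have e : (D ^ 2 + T * (η ^ 2 * V + D ^ 2 / T)) / (2 * η * T) = 3 / 2 * D * S := by
    have hV2 : V = S ^ 2 * T := by rw [hS2]; field_simp
    rw [hV2, hη]; field_simp; norm_num
  rw [← hV, e]
  calc 3 / 2 * D * S ≤ 3 / 2 * D * (10 / 3 * (B / √N * √(d / C))) := by gcongr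
    _ = 5 * (D * B / √N * √(d / C)) := by ring

lemma minimaxError_scaledTransmission_le {d N : ℕ} {D B P σ SNR : ℝ} (hd : 1 ≤ d) (hD : 0 < D)
    (hB : 0 < B) (hP : 0 < P) (hσ : 0 < σ) (hS : SNR = P / σ ^ 2) (hS1 : SNR ∈ Set.Ioo (0 : ℝ) 1)
    (hN : (d : ℝ) / Real.logb 2 (1 + SNR) ≤ (N : ℝ)) :
    minimaxError (scaledTransmission d B P) D σ N ≤
      ((5 * (D * B / √N * √(d / Real.logb 2 (1 + SNR))) : ℝ) : EReal) :=
  iSup₂_le fun _ hX => minimaxErrorOn_scaledTransmission_le hd hD hB hP hσ hS hS1 hN hX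

/-- A larger class of codes has a smaller min-max error. -/
lemma minimaxError_anti {d : ℕ} {B P : ℝ} {C C' : CodeClass d B P} (h : ∀ ℓ, C ℓ ⊆ C' ℓ)
    (D σ : ℝ) (N : ℕ) : minimaxError C' D σ N ≤ minimaxError C D σ N :=
  iSup₂_mono fun _ _ => iInf₂_mono fun ℓ _ => iInf₂_mono fun _ _ => iInf_mono fun _ =>
    le_iInf fun hc => iInf_le_of_le (h ℓ hc) le_rfl

lemma scaledTransmission_subset_analogCodes (d : ℕ) (B P : ℝ) (ℓ : ℕ) :
    scaledTransmission d B P ℓ ⊆ analogCodes d B P ℓ := by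
  rintro c ⟨rfl, hc⟩
  refine ⟨le_rfl, fun _ => Matrix.diagonal fun _ => √(P * ℓ) / B, fun g u i => ?_⟩
  rw [hc]
  simp [Matrix.diagonal_apply]

/-! ### Biased sign vectors and an entropy inequality -/

/-- The sign encoded by a Boolean. -/
def sgn (b : Bool) : ℝ := if b then 1 else -1

lemma sgn_not (b : Bool) : sgn (!b) = -sgn b := by cases b <;> simp [sgn]

lemma sgn_mul_self (b : Bool) : sgn b * sgn b = 1 := by cases b <;> simp [sgn]

lemma sgn_sq (b : Bool) : sgn b ^ 2 = 1 := by rw [sq, sgn_mul_self]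

lemma abs_sgn (b : Bool) : |sgn b| = 1 := by cases b <;> simp [sgn]

/-- The probability of the sign `b` when the mean is `δ` times the sign `a`. -/
def signProb (δ : ℝ) (a b : Bool) : ℝ := (1 + δ * sgn a * sgn b) / 2

lemma signProb_pos {δ : ℝ} (h0 : 0 ≤ δ) (h1 : δ < 1) (a b : Bool) : 0 < signProb δ a b := by
  cases a <;> cases b <;> simp [signProb, sgn] <;> linarith

lemma sum_signProb (δ : ℝ) (a : Bool) : ∑ b, signProb δ a b = 1 := by
  cases a <;> simp [signProb, sgn] <;> ring

/-- The relative change of the probability of the sign `b` when the bias is reversed. -/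
def signRatio (δ : ℝ) (a b : Bool) : ℝ := signProb δ (!a) b / signProb δ a b - 1

lemma sum_signProb_mul_signRatio {δ : ℝ} (h0 : 0 ≤ δ) (h1 : δ < 1) (a : Bool) :
    ∑ b, signProb δ a b * signRatio δ a b = 0 := by
  have h : ∀ b, signProb δ a b * signRatio δ a b = signProb δ (!a) b - signProb δ a b := fun b => by
    rw [signRatio, mul_sub, mul_div_cancel₀ _ (signProb_pos h0 h1 a b).ne', mul_one]
  simp only [h, Finset.sum_sub_distrib, sum_signProb, sub_self]

/-- Reversing the bias changes each probability by δ, and for δ ≤ 1/2 no probability is below 1/4.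
-/
lemma abs_signRatio_le {δ : ℝ} (h0 : 0 ≤ δ) (h1 : δ ≤ 1 / 2) (a b : Bool) :
    |signRatio δ a b| ≤ 4 * δ := by
  have hp := signProb_pos h0 (by linarith) a b
  have h : signRatio δ a b = (-(δ * sgn a * sgn b)) / signProb δ a b := by
    rw [signRatio, sub_eq_iff_eq_add, div_eq_iff hp.ne', add_mul, div_mul_cancel₀ _ hp.ne']
    simp only [signProb, sgn_not]; ring
  rw [h, abs_div, abs_of_pos hp, abs_neg, abs_mul, abs_mul, abs_sgn, abs_sgn, abs_of_nonneg h0,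
    div_le_iff₀ hp]
  have : 1 / 4 ≤ signProb δ a b := by
    cases a <;> cases b <;> simp [signProb, sgn] <;> linarith
  nlinarith

/-- Hoeffding's lemma for a biased sign. -/
lemma sum_signProb_mul_exp_le {δ : ℝ} (h0 : 0 < δ) (h1 : δ ≤ 1 / 2) (a : Bool) (t : ℝ) :
    ∑ b, signProb δ a b * Real.exp (t * signRatio δ a b) ≤ Real.exp ((t * (4 * δ)) ^ 2 / 2) := by
  set K := 4 * δ with hK
  have hK0 : 0 < K := by positivity
  -- The chord of the convex function exp over [−tK, tK]; its linear part averages to zero because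
  -- `signRatio` is centred.
  have hconv : ∀ x, |x| ≤ K → Real.exp (t * x) ≤
      Real.cosh (t * K) + x * (Real.sinh (t * K) / K) := by
    intro x hx
    have hx' := abs_le.1 hx
    have ha : 0 ≤ (K + x) / (2 * K) := div_nonneg (by linarith) (by positivity)
    have hb : 0 ≤ (K - x) / (2 * K) := div_nonneg (by linarith) (by positivity)
    have h := convexOn_exp.2 (Set.mem_univ (t * K)) (Set.mem_univ (-(t * K))) ha hb
      (by field_simp; ring)
    simp only [smul_eq_mul] at h
    have e : (K + x) / (2 * K) * (t * K) + (K - x) / (2 * K) * -(t * K) = t * x := by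
      field_simp; ring
    rw [e] at h
    refine h.trans (le_of_eq ?_)
    rw [Real.cosh_eq, Real.sinh_eq]
    field_simp; ring
  refine le_trans ?_ (Real.cosh_le_exp_half_sq _)
  calc ∑ b, signProb δ a b * Real.exp (t * signRatio δ a b)
      ≤ ∑ b, (signProb δ a b * Real.cosh (t * K) +
          signProb δ a b * signRatio δ a b * (Real.sinh (t * K) / K)) := by
        refine Finset.sum_le_sum fun b _ => ?_
        rw [mul_assoc, ← mul_add]
        exact mul_le_mul_of_nonneg_left (hconv _ (abs_signRatio_le h0.le h1 a b))
          (signProb_pos h0.le (by linarith) a b).le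
    _ = Real.cosh (t * K) := by
        rw [Finset.sum_add_distrib, ← Finset.sum_mul, ← Finset.sum_mul, sum_signProb,
          sum_signProb_mul_signRatio h0.le (by linarith)]
        ring

section Cube

variable {d : ℕ}

/-- Reverse the sign number `i`. -/
def flipAt (i : Fin d) (v : Fin d → Bool) : Fin d → Bool := Function.update v i (!v i)

lemma flipAt_flipAt (i : Fin d) (v : Fin d → Bool) : flipAt i (flipAt i v) = v := by
  simp [flipAt]

lemma flipAt_apply_self (i : Fin d) (v : Fin d → Bool) : flipAt i v i = !v i := by simp [flipAt]

/-- The probability of the sign vector `s` when the signs are independent with means `δ vᵢ`. -/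
def cubeProb (δ : ℝ) (v s : Fin d → Bool) : ℝ := ∏ i, signProb δ (v i) (s i)

lemma cubeProb_pos {δ : ℝ} (h0 : 0 ≤ δ) (h1 : δ < 1) (v s : Fin d → Bool) : 0 < cubeProb δ v s :=
  Finset.prod_pos fun _ _ => signProb_pos h0 h1 _ _

lemma sum_cubeProb_mul_prod (δ : ℝ) (v : Fin d → Bool) (F : Fin d → Bool → ℝ) :
    ∑ s, cubeProb δ v s * ∏ i, F i (s i) = ∏ i, ∑ b, signProb δ (v i) b * F i b := by
  rw [Finset.prod_univ_sum, Fintype.piFinset_univ]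
  exact Finset.sum_congr rfl fun s _ => by rw [cubeProb, Finset.prod_mul_distrib]

lemma sum_cubeProb (δ : ℝ) (v : Fin d → Bool) : ∑ s, cubeProb δ v s = 1 := by
  have h := sum_cubeProb_mul_prod δ v fun _ _ => 1
  simpa only [Finset.prod_const_one, mul_one, sum_signProb] using h

lemma sum_cubeProb_mul_sgn (δ : ℝ) (v : Fin d → Bool) (i : Fin d) :
    ∑ s, cubeProb δ v s * sgn (s i) = δ * sgn (v i) := by
  classical
  have h := sum_cubeProb_mul_prod δ v fun j b => if j = i then sgn b else 1
  have e1 : ∀ s : Fin d → Bool, ∏ j, (if j = i then sgn (s j) else 1) = sgn (s i) := fun s => by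
    simp
  have e2 : ∀ j, ∑ b, signProb δ (v j) b * (if j = i then sgn b else 1) =
      if j = i then δ * sgn (v i) else 1 := by
    intro j
    split_ifs with hj
    · subst hj
      simp [signProb, sgn]; ring
    · simpa using sum_signProb δ (v j)
  simp only [e1, e2] at h
  simpa using h

/-- Only the i-th factor changes, so the difference of the two laws is a multiplier depending on `s
i` alone. Reversing a sign thus becomes a correlation with `signRatio`. -/
lemma cubeProb_flipAt {δ : ℝ} (h0 : 0 ≤ δ) (h1 : δ < 1) (i : Fin d) (v s : Fin d → Bool) :
    cubeProb δ (flipAt i v) s = cubeProb δ v s + cubeProb δ v s * signRatio δ (v i) (s i) := by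
  classical
  rw [cubeProb, cubeProb, ← Finset.mul_prod_erase _ _ (Finset.mem_univ i),
    ← Finset.mul_prod_erase (a := i) _ (fun j => signProb δ (v j) (s j)) (Finset.mem_univ i)]
  have e : ∏ j ∈ Finset.univ.erase i, signProb δ (flipAt i v j) (s j) =
      ∏ j ∈ Finset.univ.erase i, signProb δ (v j) (s j) :=
    Finset.prod_congr rfl fun j hj => by
      rw [flipAt, Function.update_of_ne (Finset.ne_of_mem_erase hj)]
  rw [e, flipAt_apply_self, signRatio]
  have := (signProb_pos h0 h1 (v i) (s i)).ne'
  field_simp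
  ring

/-- The moment generating function of a linear combination of the relative changes. -/
lemma sum_cubeProb_mul_exp_le {δ : ℝ} (h0 : 0 < δ) (h1 : δ ≤ 1 / 2) (v : Fin d → Bool)
    (t : Fin d → ℝ) :
    ∑ s, cubeProb δ v s * Real.exp (∑ i, t i * signRatio δ (v i) (s i)) ≤
      Real.exp (∑ i, (t i * (4 * δ)) ^ 2 / 2) := by
  simp only [Real.exp_sum]
  rw [sum_cubeProb_mul_prod δ v fun i b => Real.exp (t i * signRatio δ (v i) b)]
  exact Finset.prod_le_prod (fun i _ => Finset.sum_nonneg fun b _ =>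
    mul_nonneg (signProb_pos h0.le (by linarith) _ _).le (Real.exp_pos _).le)
    fun i _ => sum_signProb_mul_exp_le h0 h1 (v i) (t i)

/-- The squared correlations of a positive function with the relative changes of the cube
distribution are controlled by its entropy. -/
lemma sum_sq_le_entropy {δ : ℝ} (h0 : 0 < δ) (h1 : δ ≤ 1 / 2) (v : Fin d → Bool)
    (w : (Fin d → Bool) → ℝ) (hw : ∀ s, 0 < w s) :
    ∑ i, (∑ s, cubeProb δ (flipAt i v) s * w s - ∑ s, cubeProb δ v s * w s) ^ 2 /
        (∑ s, cubeProb δ v s * w s) ≤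
      2 * (4 * δ) ^ 2 * (∑ s, cubeProb δ v s * (w s * Real.log (w s)) -
        ∑ s, cubeProb δ v s * w s + 1) := by
  have hδ1 : δ < 1 := by linarith
  set K := 4 * δ with hK
  have hK0 : 0 < K := by positivity
  set p := cubeProb δ v with hp
  have hp0 : ∀ s, 0 < p s := cubeProb_pos h0.le hδ1 v
  have hp1 : ∑ s, p s = 1 := sum_cubeProb δ v
  set m := ∑ s, p s * w s with hm
  have hm0 : 0 < m := Finset.sum_pos (fun s _ => mul_pos (hp0 s) (hw s)) Finset.univ_nonempty
  have hA : ∀ i, ∑ s, cubeProb δ (flipAt i v) s * w s - m =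
      ∑ s, p s * w s * signRatio δ (v i) (s i) := fun i => by
    rw [hm, ← Finset.sum_sub_distrib]
    refine Finset.sum_congr rfl fun s _ => ?_
    rw [cubeProb_flipAt h0.le hδ1, ← hp]; ring
  simp only [hA]
  set A : Fin d → ℝ := fun i => ∑ s, p s * w s * signRatio δ (v i) (s i) with hAdef
  -- The maximiser of ∑ (tᵢAᵢ/m − tᵢ²K²/2), the difference between the tilted mean of F and its
  -- Hoeffding bound κ.
  set t : Fin d → ℝ := fun i => A i / m / K ^ 2 with ht
  set Q := ∑ i, A i ^ 2 with hQ
  set κ := ∑ i, (t i * K) ^ 2 / 2 with hκ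
  have hκQ : κ = Q / (2 * m ^ 2 * K ^ 2) := by
    rw [hκ, hQ, Finset.sum_div]
    refine Finset.sum_congr rfl fun i _ => ?_
    rw [ht]; field_simp
  set F : (Fin d → Bool) → ℝ := fun s => ∑ i, t i * signRatio δ (v i) (s i) with hF
  have hmgf : ∑ s, p s * Real.exp (F s) ≤ Real.exp κ := sum_cubeProb_mul_exp_le h0 h1 v t
  have hlin : ∑ s, p s * w s * F s = Q / (m * K ^ 2) := by
    simp only [hF, Finset.mul_sum]
    rw [Finset.sum_comm, hQ, Finset.sum_div]
    refine Finset.sum_congr rfl fun i _ => ?_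
    have : ∑ s, p s * w s * (t i * signRatio δ (v i) (s i)) = t i * A i := by
      rw [hAdef, Finset.mul_sum]
      exact Finset.sum_congr rfl fun s _ => by ring
    rw [this, ht]; field_simp
  -- The pointwise form, via 1 + x ≤ eˣ, of the Gibbs variational inequality for the tilted weights
  -- p·w/m and the test function F − κ.
  have hyoung : ∀ s, p s * w s * (1 + F s - κ - Real.log (w s) + Real.log m) ≤
      m * (p s * Real.exp (F s) * Real.exp (-κ)) := by
    intro s
    have h2 := Real.add_one_le_exp (F s - κ - Real.log (w s) + Real.log m)
    have e : Real.exp (F s - κ - Real.log (w s) + Real.log m) =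
        Real.exp (F s) * Real.exp (-κ) * m / w s := by
      rw [Real.exp_add, Real.exp_sub, sub_eq_add_neg, Real.exp_add, Real.exp_log (hw s),
        Real.exp_log hm0]
      ring
    rw [e] at h2
    have h3 := mul_le_mul_of_nonneg_left h2 (mul_pos (hp0 s) (hw s)).le
    have e2 : p s * w s * (Real.exp (F s) * Real.exp (-κ) * m / w s) =
        m * (p s * Real.exp (F s) * Real.exp (-κ)) := by
      have := (hw s).ne'
      field_simp
    rw [e2] at h3
    linarith
  have hsum := Finset.sum_le_sum fun s (_ : s ∈ Finset.univ) => hyoung s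
  have hR : ∑ s, m * (p s * Real.exp (F s) * Real.exp (-κ)) ≤ m := by
    rw [← Finset.mul_sum, ← Finset.sum_mul]
    have := mul_le_mul_of_nonneg_right hmgf (Real.exp_pos (-κ)).le
    rw [← Real.exp_add, add_neg_cancel, Real.exp_zero] at this
    nlinarith
  have hL : ∑ s, p s * w s * (1 + F s - κ - Real.log (w s) + Real.log m) =
      m * (1 - κ + Real.log m) + Q / (m * K ^ 2) - ∑ s, p s * (w s * Real.log (w s)) := by
    rw [← hlin, hm, Finset.sum_mul, ← Finset.sum_add_distrib, ← Finset.sum_sub_distrib]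
    exact Finset.sum_congr rfl fun s _ => by ring
  rw [hL] at hsum
  -- Replacing m log m by m − 1 makes the bound affine in m, so that it can be integrated over
  -- observations with only ∫ m = 1 known.
  have hlog : m - 1 ≤ m * Real.log m := by
    have := mul_le_mul_of_nonneg_left (Real.one_sub_inv_le_log_of_pos hm0) hm0.le
    rwa [mul_sub, mul_one, mul_inv_cancel₀ hm0.ne'] at this
  have hfin : Q / (2 * m * K ^ 2) ≤ ∑ s, p s * (w s * Real.log (w s)) - m + 1 := by
    have e1 : m * κ = Q / (2 * m * K ^ 2) := by rw [hκQ]; field_simp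
    have e2 : Q / (m * K ^ 2) = 2 * (Q / (2 * m * K ^ 2)) := by field_simp
    rw [e2] at hsum
    nlinarith
  rw [← Finset.sum_div]
  calc Q / m = 2 * K ^ 2 * (Q / (2 * m * K ^ 2)) := by field_simp
    _ ≤ _ := mul_le_mul_of_nonneg_left hfin (by positivity)

end Cube

/-! ### Channel outputs for biased sign vectors -/

section Shift

variable {U : Type} [MeasurableSpace U] {ℓ : ℕ} {σ : ℝ}

/-- The log-likelihood ratio of the output of the Gaussian channel with input `a`, with respect to
pure noise. -/
def logRatio (σ : ℝ) (a y : Euc ℓ) : ℝ := (inner ℝ a y - ‖a‖ ^ 2 / 2) / σ ^ 2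

lemma measurable_logRatio {a : U → Euc ℓ} (ha : Measurable a) :
    Measurable fun o : U × Euc ℓ => logRatio σ (a o.1) o.2 := by
  unfold logRatio
  fun_prop

/-- The public randomness is itself observed and its law is unaffected, so the density is that of
the Gaussian shift for each fixed u. -/
lemma map_prod_noise_add (hσ : 0 < σ) (μ : Measure U) [IsProbabilityMeasure μ] {a : U → Euc ℓ}
    (ha : Measurable a) :
    (μ.prod (noise ℓ σ)).map (fun o => (o.1, a o.1 + o.2)) =
      (μ.prod (noise ℓ σ)).withDensity
        fun o => ENNReal.ofReal (Real.exp (logRatio σ (a o.1) o.2)) := by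
  refine Measure.ext_of_lintegral _ fun F hF => ?_
  have hm := (measurable_logRatio (σ := σ) ha).exp.ennreal_ofReal
  have hs : Measurable fun o : U × Euc ℓ => (o.1, a o.1 + o.2) := by fun_prop
  have hFs : Measurable fun o : U × Euc ℓ => F (o.1, a o.1 + o.2) := hF.comp hs
  rw [lintegral_map hF hs, lintegral_withDensity_eq_lintegral_mul _ hm hF,
    lintegral_prod _ hFs.aemeasurable, lintegral_prod _ (hm.mul hF).aemeasurable]
  refine lintegral_congr fun u => ?_
  have hFu : Measurable fun y => F (u, y) := hF.comp measurable_prodMk_left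
  have h1 := lintegral_map (μ := noise ℓ σ) (g := fun z => a u + z) hFu (by fun_prop)
  rw [noise_map_const_add ℓ hσ, lintegral_withDensity_eq_lintegral_mul _
    (by fun_prop) hFu] at h1
  exact h1.symm

lemma integrable_inner_prod_noise (μ : Measure U) [IsProbabilityMeasure μ] {a : U → Euc ℓ}
    (ha : Measurable a) (ha2 : Integrable (fun u => ‖a u‖ ^ 2) μ) :
    Integrable (fun o : U × Euc ℓ => inner ℝ (a o.1) o.2) (μ.prod (noise ℓ σ)) := by
  have i1 : Integrable (fun o : U × Euc ℓ => ‖a o.1‖ ^ 2) (μ.prod (noise ℓ σ)) := ha2.comp_fst _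
  have i2 : Integrable (fun o : U × Euc ℓ => ‖o.2‖ ^ 2) (μ.prod (noise ℓ σ)) :=
    (integrable_noise_norm_sq ℓ σ).comp_snd _
  refine (i1.add i2).mono' (by fun_prop) (ae_of_all _ fun o => ?_)
  have h1 := norm_inner_le_norm (𝕜 := ℝ) (a o.1) o.2
  simp only [Pi.add_apply]
  nlinarith [sq_nonneg (‖a o.1‖ - ‖o.2‖), sq_nonneg ‖a o.1‖, sq_nonneg ‖o.2‖]

/-- The relative entropy of the output of the Gaussian channel with respect to pure noise. -/
lemma integral_exp_mul_logRatio (hσ : 0 < σ) (μ : Measure U) [IsProbabilityMeasure μ]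
    {a : U → Euc ℓ} (ha : Measurable a) (ha2 : Integrable (fun u => ‖a u‖ ^ 2) μ) :
    Integrable (fun o : U × Euc ℓ => Real.exp (logRatio σ (a o.1) o.2) * logRatio σ (a o.1) o.2)
      (μ.prod (noise ℓ σ)) ∧
    ∫ o, Real.exp (logRatio σ (a o.1) o.2) * logRatio σ (a o.1) o.2 ∂(μ.prod (noise ℓ σ)) =
      (∫ u, ‖a u‖ ^ 2 ∂μ) / (2 * σ ^ 2) := by
  have hm := measurable_logRatio (σ := σ) ha
  have hs : Measurable fun o : U × Euc ℓ => (o.1, a o.1 + o.2) := by fun_prop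
  have hdens := map_prod_noise_add hσ μ ha
  -- The weight exp(logRatio) moves the integral to the actual output a + z, where the log-ratio is
  -- ⟨a, z⟩/σ² + ‖a‖²/(2σ²) and the first term has mean zero.
  have e : ∀ o : U × Euc ℓ, logRatio σ (a o.1) (a o.1 + o.2) =
      (1 / σ ^ 2) * inner ℝ (a o.1) o.2 + (1 / (2 * σ ^ 2)) * ‖a o.1‖ ^ 2 := fun o => by
    rw [logRatio, inner_add_right, real_inner_self_eq_norm_sq]
    field_simp; ring
  have i1 := (integrable_inner_prod_noise (σ := σ) μ ha ha2).const_mul (1 / σ ^ 2)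
  have i2 : Integrable (fun o : U × Euc ℓ => (1 / (2 * σ ^ 2)) * ‖a o.1‖ ^ 2)
      (μ.prod (noise ℓ σ)) := (ha2.comp_fst _).const_mul _
  have hi : Integrable (fun o : U × Euc ℓ => logRatio σ (a o.1) o.2)
      ((μ.prod (noise ℓ σ)).map (fun o => (o.1, a o.1 + o.2))) := by
    rw [integrable_map_measure hm.aestronglyMeasurable hs.aemeasurable]
    refine (i1.add i2).congr (ae_of_all _ fun o => ?_)
    exact (e o).symm
  have hval : ∫ o, logRatio σ (a o.1) o.2 ∂((μ.prod (noise ℓ σ)).map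
      (fun o => (o.1, a o.1 + o.2))) = (∫ u, ‖a u‖ ^ 2 ∂μ) / (2 * σ ^ 2) := by
    rw [integral_map hs.aemeasurable hm.aestronglyMeasurable]
    simp only [e]
    rw [integral_add i1 i2, integral_const_mul, integral_const_mul,
      integral_prod _ (integrable_inner_prod_noise (σ := σ) μ ha ha2)]
    simp only [integral_noise_inner, integral_zero, mul_zero, zero_add]
    rw [integral_fun_fst (fun u => ‖a u‖ ^ 2)]
    simp only [probReal_univ, smul_eq_mul, one_mul]
    ring
  have htr : ∀ o : U × Euc ℓ,
      (ENNReal.ofReal (Real.exp (logRatio σ (a o.1) o.2))).toReal • logRatio σ (a o.1) o.2 =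
        Real.exp (logRatio σ (a o.1) o.2) * logRatio σ (a o.1) o.2 := fun o => by
    rw [ENNReal.toReal_ofReal (Real.exp_pos _).le, smul_eq_mul]
  rw [hdens] at hi hval
  constructor
  · rw [integrable_withDensity_iff_integrable_smul' hm.exp.ennreal_ofReal
      (ae_of_all _ fun _ => ENNReal.ofReal_lt_top)] at hi
    exact hi.congr (ae_of_all _ htr)
  · rw [integral_withDensity_eq_integral_toReal_smul hm.exp.ennreal_ofReal
      (ae_of_all _ fun _ => ENNReal.ofReal_lt_top)] at hval
    rw [← hval]
    exact integral_congr_ae (ae_of_all _ fun o => (htr o).symm)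

end Shift

section Mixture

variable {d ℓ : ℕ} {B P : ℝ}

/-- The gradient estimate with sign vector `s` and norm `B`. -/
def gradVec (B : ℝ) (s : Fin d → Bool) : Euc d := WithLp.toLp 2 fun i => B / √d * sgn (s i)

lemma norm_sq_gradVec (hd : 1 ≤ d) (B : ℝ) (s : Fin d → Bool) : ‖gradVec B s‖ ^ 2 = B ^ 2 := by
  have hd' : (0 : ℝ) < d := by exact_mod_cast hd
  simp only [gradVec, EuclideanSpace.norm_sq_eq, Real.norm_eq_abs, sq_abs, mul_pow, div_pow, sgn_sq,
    mul_one, Finset.sum_const, Finset.card_univ, Fintype.card_fin, nsmul_eq_mul,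
    Real.sq_sqrt hd'.le]
  field_simp

/-- The law of the gradient estimate whose signs are independent with means `δ vᵢ`. -/
def gradLaw (B δ : ℝ) (v : Fin d → Bool) : Measure (Euc d) :=
  ∑ s, ENNReal.ofReal (cubeProb δ v s) • Measure.dirac (gradVec B s)

lemma lintegral_gradLaw (B δ : ℝ) (v : Fin d → Bool) {F : Euc d → ℝ≥0∞} (hF : Measurable F) :
    ∫⁻ g, F g ∂(gradLaw B δ v) = ∑ s, ENNReal.ofReal (cubeProb δ v s) * F (gradVec B s) := by
  rw [gradLaw, lintegral_finsetSum_measure]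
  refine Finset.sum_congr rfl fun s _ => ?_
  rw [lintegral_smul_measure, lintegral_dirac' _ hF, smul_eq_mul]

lemma isProbabilityMeasure_gradLaw (B : ℝ) {δ : ℝ} (h0 : 0 ≤ δ) (h1 : δ < 1) (v : Fin d → Bool) :
    IsProbabilityMeasure (gradLaw B δ v) := by
  refine ⟨?_⟩
  have h := lintegral_gradLaw B δ v (measurable_const (a := (1 : ℝ≥0∞)))
  rw [lintegral_one] at h
  rw [h]
  simp only [mul_one]
  rw [← ENNReal.ofReal_sum_of_nonneg fun s _ => (cubeProb_pos h0 h1 v s).le, sum_cubeProb,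
    ENNReal.ofReal_one]

lemma integral_gradLaw (B : ℝ) {δ : ℝ} (h0 : 0 ≤ δ) (h1 : δ < 1) (v : Fin d → Bool) :
    ∫ g, g ∂(gradLaw B δ v) = δ • gradVec B v := by
  rw [gradLaw, integral_finsetSum_measure fun s _ =>
    (integrable_dirac (by simp)).smul_measure ENNReal.ofReal_ne_top]
  simp only [integral_smul_measure, integral_dirac,
    ENNReal.toReal_ofReal (cubeProb_pos h0 h1 v _).le]
  ext i
  have h := sum_cubeProb_mul_sgn δ v i
  simp only [WithLp.ofLp_sum, WithLp.ofLp_smul, Finset.sum_apply, Pi.smul_apply, smul_eq_mul,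
    gradVec]
  calc ∑ s, cubeProb δ v s * (B / √d * sgn (s i)) =
      B / √d * ∑ s, cubeProb δ v s * sgn (s i) := by
        rw [Finset.mul_sum]; exact Finset.sum_congr rfl fun s _ => by ring
    _ = _ := by rw [h]; ring

lemma lintegral_norm_sq_gradLaw (hd : 1 ≤ d) (B : ℝ) {δ : ℝ} (h0 : 0 ≤ δ) (h1 : δ < 1)
    (v : Fin d → Bool) :
    ∫⁻ g, ‖g‖ₑ ^ 2 ∂(gradLaw B δ v) = ENNReal.ofReal (B ^ 2) := by
  rw [lintegral_gradLaw _ _ _ (by fun_prop)]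
  have e : ∀ s : Fin d → Bool, ‖gradVec B s‖ₑ ^ 2 = ENNReal.ofReal (B ^ 2) := fun s => by
    rw [← ofReal_norm, ← ENNReal.ofReal_pow (norm_nonneg _), norm_sq_gradVec hd]
  simp only [e]
  rw [← Finset.sum_mul, ← ENNReal.ofReal_sum_of_nonneg fun s _ => (cubeProb_pos h0 h1 v s).le,
    sum_cubeProb, ENNReal.ofReal_one, one_mul]

variable (c : Code d ℓ B P) (σ δ : ℝ)

/-- The likelihood ratio of an observation for the gradient estimate with sign vector `s`. -/
def obsRatio (s : Fin d → Bool) (o : Obs c) : ℝ :=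
  Real.exp (logRatio σ (c.enc (gradVec B s) o.1) o.2)

/-- The likelihood ratio of an observation for the gradient estimate with bias `δ v`. -/
def mixRatio (v : Fin d → Bool) (o : Obs c) : ℝ := ∑ s, cubeProb δ v s * obsRatio c σ s o

lemma measurable_enc_gradVec (s : Fin d → Bool) : Measurable fun u => c.enc (gradVec B s) u :=
  c.measurable_enc.comp measurable_prodMk_left

lemma measurable_obsRatio (s : Fin d → Bool) : Measurable (obsRatio c σ s) :=
  (measurable_logRatio (measurable_enc_gradVec c s)).exp

lemma measurable_mixRatio (v : Fin d → Bool) : Measurable (mixRatio c σ δ v) :=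
  Finset.measurable_fun_sum _ fun s _ => (measurable_obsRatio c σ s).const_mul _

variable {σ δ}

lemma mixRatio_pos (h0 : 0 ≤ δ) (h1 : δ < 1) (v : Fin d → Bool) (o : Obs c) :
    0 < mixRatio c σ δ v o :=
  Finset.sum_pos (fun s _ => mul_pos (cubeProb_pos h0 h1 v s) (Real.exp_pos _))
    Finset.univ_nonempty

/-- One reference measure, public randomness times pure noise, serves for all sign vectors, and the
density does not depend on the query `x`. -/
lemma observe_eq_withDensity (hσ : 0 < σ) (h0 : 0 ≤ δ) (h1 : δ < 1) (v : Fin d → Bool)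
    {X : Set (Euc d)} (O : Kernel X (Euc d)) [IsMarkovKernel O] (x : X)
    (hO : O x = gradLaw B δ v) :
    observe c σ O x = (c.lawU.prod (noise ℓ σ)).withDensity
      fun o => ENNReal.ofReal (mixRatio c σ δ v o) := by
  refine Measure.ext_of_lintegral _ fun F hF => ?_
  have := isProbabilityMeasure_gradLaw B h0 h1 v
  have hm := measurable_observe_map c
  have hFm : Measurable fun p : Euc d × c.U × Euc ℓ => F (p.2.1, c.enc p.1 p.2.1 + p.2.2) :=
    hF.comp hm
  rw [observe_apply, hO, lintegral_map hF hm, lintegral_prod _ hFm.aemeasurable,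
    lintegral_gradLaw _ _ _ hFm.lintegral_prod_right',
    lintegral_withDensity_eq_lintegral_mul _ (measurable_mixRatio c σ δ v).ennreal_ofReal hF]
  have e : ∀ o, ENNReal.ofReal (mixRatio c σ δ v o) * F o =
      ∑ s, ENNReal.ofReal (cubeProb δ v s) * (ENNReal.ofReal (obsRatio c σ s o) * F o) := fun o => by
    have hpos : ∀ s ∈ Finset.univ, 0 ≤ cubeProb δ v s * obsRatio c σ s o := fun s _ =>
      mul_nonneg (cubeProb_pos h0 h1 v s).le (Real.exp_pos _).le
    rw [mixRatio, ENNReal.ofReal_sum_of_nonneg hpos, Finset.sum_mul]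
    refine Finset.sum_congr rfl fun s _ => ?_
    rw [ENNReal.ofReal_mul (cubeProb_pos h0 h1 v s).le, mul_assoc]
  simp only [Pi.mul_apply, e]
  have hw : ∀ s, Measurable fun o => ENNReal.ofReal (obsRatio c σ s o) * F o := fun s =>
    (measurable_obsRatio c σ s).ennreal_ofReal.mul hF
  rw [lintegral_finsetSum _ fun s _ => (hw s).const_mul _]
  refine Finset.sum_congr rfl fun s _ => ?_
  rw [lintegral_const_mul _ (hw s)]
  congr 1
  have h2 := map_prod_noise_add hσ c.lawU (measurable_enc_gradVec c s)
  have hs : Measurable fun o : Obs c => (o.1, c.enc (gradVec B s) o.1 + o.2) := by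
    have := measurable_enc_gradVec c s
    fun_prop
  have h3 := lintegral_map (μ := c.lawU.prod (noise ℓ σ)) hF hs
  rw [h2, lintegral_withDensity_eq_lintegral_mul _
    (measurable_logRatio (measurable_enc_gradVec c s)).exp.ennreal_ofReal hF] at h3
  exact h3.symm

lemma integral_mixRatio (hσ : 0 < σ) (h0 : 0 ≤ δ) (h1 : δ < 1) (v : Fin d → Bool) :
    Integrable (mixRatio c σ δ v) (c.lawU.prod (noise ℓ σ)) ∧
      ∫ o, mixRatio c σ δ v o ∂(c.lawU.prod (noise ℓ σ)) = 1 := by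
  have hp := isProbabilityMeasure_gradLaw B h0 h1 v
  -- A constant oracle on the whole space is introduced only to read off the total mass 1.
  have h := observe_eq_withDensity c hσ h0 h1 v (X := Set.univ)
    (Kernel.const _ (gradLaw B δ v)) ⟨0, trivial⟩ rfl
  have h2 : ∫⁻ o, ENNReal.ofReal (mixRatio c σ δ v o) ∂(c.lawU.prod (noise ℓ σ)) = 1 := by
    rw [← setLIntegral_univ, ← withDensity_apply _ MeasurableSet.univ, ← h, measure_univ]
  have hm := measurable_mixRatio c σ δ v
  have hpos := fun o => (mixRatio_pos c (σ := σ) h0 h1 v o).le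
  refine ⟨⟨hm.aestronglyMeasurable, ?_⟩, ?_⟩
  · rw [hasFiniteIntegral_iff_ofReal (ae_of_all _ hpos), h2]
    exact ENNReal.one_lt_top
  · rw [integral_eq_lintegral_of_nonneg_ae (ae_of_all _ hpos) hm.aestronglyMeasurable, h2,
      ENNReal.toReal_one]

/-- The chi-square divergence of the observation laws when the sign `i` of `v` is reversed. -/
def chiSq (c : Code d ℓ B P) (σ δ : ℝ) (v : Fin d → Bool) (i : Fin d) : ℝ :=
  ∫ o, (mixRatio c σ δ (flipAt i v) o - mixRatio c σ δ v o) ^ 2 / mixRatio c σ δ v o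
    ∂(c.lawU.prod (noise ℓ σ))

lemma chiSq_nonneg (h0 : 0 ≤ δ) (h1 : δ < 1) (v : Fin d → Bool) (i : Fin d) :
    0 ≤ chiSq c σ δ v i :=
  integral_nonneg fun o => div_nonneg (sq_nonneg _) (mixRatio_pos c h0 h1 v o).le

/-- The pointwise bound on `signRatio` survives averaging. It dominates the chi-square integrand by
(4δ)² times `mixRatio`, hence its integrability. -/
lemma abs_mixRatio_flipAt_sub_le (h0 : 0 ≤ δ) (h1 : δ ≤ 1 / 2) (v : Fin d → Bool) (i : Fin d)
    (o : Obs c) :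
    |mixRatio c σ δ (flipAt i v) o - mixRatio c σ δ v o| ≤ 4 * δ * mixRatio c σ δ v o := by
  rw [mixRatio, mixRatio, ← Finset.sum_sub_distrib, Finset.mul_sum]
  refine (Finset.abs_sum_le_sum_abs _ _).trans (Finset.sum_le_sum fun s _ => ?_)
  have hc := cubeProb_pos h0 (by linarith) v s
  have ho : 0 < obsRatio c σ s o := Real.exp_pos _
  rw [cubeProb_flipAt h0 (by linarith), ← sub_mul, add_sub_cancel_left, abs_mul, abs_mul,
    abs_of_pos hc, abs_of_pos ho]
  have := mul_le_mul_of_nonneg_left (abs_signRatio_le h0 h1 (v i) (s i)) (mul_pos hc ho).le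
  linarith

lemma integrable_chiSq (hσ : 0 < σ) (h0 : 0 ≤ δ) (h1 : δ ≤ 1 / 2) (v : Fin d → Bool) (i : Fin d) :
    Integrable (fun o => (mixRatio c σ δ (flipAt i v) o - mixRatio c σ δ v o) ^ 2 /
      mixRatio c σ δ v o) (c.lawU.prod (noise ℓ σ)) := by
  have hm := measurable_mixRatio c σ δ
  refine ((integral_mixRatio c hσ h0 (by linarith) v).1.const_mul ((4 * δ) ^ 2)).mono'
    ((((hm _).sub (hm v)).pow_const 2).div (hm v)).aestronglyMeasurable (ae_of_all _ fun o => ?_)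
  have hp := mixRatio_pos c (σ := σ) h0 (by linarith) v o
  rw [Real.norm_of_nonneg (by positivity), div_le_iff₀ hp]
  have h := pow_le_pow_left₀ (abs_nonneg _) (abs_mixRatio_flipAt_sub_le c (σ := σ) h0 h1 v i o) 2
  rw [sq_abs] at h
  linarith

/-- The information bound: the chi-square divergences in the `d` directions add up to at most the
channel capacity times `δ²`, up to a constant. -/
lemma sum_chiSq_le (hd : 1 ≤ d) (hP : 0 < P) (hσ : 0 < σ) (h0 : 0 < δ) (h1 : δ ≤ 1 / 2)
    (v : Fin d → Bool) :
    ∑ i, chiSq c σ δ v i ≤ (4 * δ) ^ 2 * (ℓ * (P / σ ^ 2)) := by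
  have hδ1 : δ < 1 := by linarith
  have hpow := c.power (gradLaw B δ v) (isProbabilityMeasure_gradLaw B h0.le hδ1 v)
    (lintegral_norm_sq_gradLaw hd B h0.le hδ1 v).le
  have hmeas : Measurable fun g : Euc d => ∫⁻ u, ‖c.enc g u‖ₑ ^ 2 ∂c.lawU :=
    (c.measurable_enc.enorm.pow_const 2).lintegral_prod_right'
  rw [lintegral_gradLaw _ _ _ hmeas] at hpow
  -- The power constraint is on an average over `s`, but every `s` has positive probability, so each
  -- single input has finite power.
  have hfin : ∀ s : Fin d → Bool, ∫⁻ u, ‖c.enc (gradVec B s) u‖ₑ ^ 2 ∂c.lawU < ⊤ := by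
    intro s
    have h2 := (Finset.single_le_sum (f := fun s => ENNReal.ofReal (cubeProb δ v s) *
      ∫⁻ u, ‖c.enc (gradVec B s) u‖ₑ ^ 2 ∂c.lawU) (fun _ _ => zero_le) (Finset.mem_univ s)).trans
      hpow
    by_contra htop
    rw [not_lt, top_le_iff] at htop
    simp only [htop] at h2
    rw [ENNReal.mul_top (by simpa using cubeProb_pos h0.le hδ1 v s)] at h2
    exact absurd h2 ENNReal.ofReal_lt_top.not_ge
  have hint : ∀ s : Fin d → Bool, Integrable (fun u => ‖c.enc (gradVec B s) u‖ ^ 2) c.lawU := by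
    intro s
    refine ⟨((measurable_enc_gradVec c s).norm.pow_const 2).aestronglyMeasurable, ?_⟩
    simpa [hasFiniteIntegral_iff_enorm] using hfin s
  have hpow' : ∑ s, cubeProb δ v s * ∫ u, ‖c.enc (gradVec B s) u‖ ^ 2 ∂c.lawU ≤ ℓ * P := by
    rw [← ENNReal.ofReal_le_ofReal_iff (by positivity)]
    refine le_trans (le_of_eq ?_) hpow
    rw [ENNReal.ofReal_sum_of_nonneg fun s _ => mul_nonneg (cubeProb_pos h0.le hδ1 v s).le
      (integral_nonneg fun _ => by positivity)]
    refine Finset.sum_congr rfl fun s _ => ?_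
    rw [ENNReal.ofReal_mul (cubeProb_pos h0.le hδ1 v s).le,
      ofReal_integral_eq_lintegral_ofReal (hint s) (ae_of_all _ fun _ => by positivity)]
    congr 1
    refine lintegral_congr fun u => ?_
    rw [ENNReal.ofReal_pow (norm_nonneg _), ofReal_norm]
  have hKL := fun s => integral_exp_mul_logRatio hσ c.lawU (measurable_enc_gradVec c s) (hint s)
  obtain ⟨imix, emix⟩ := integral_mixRatio c hσ h0.le hδ1 v
  have ient : Integrable (fun o : Obs c => ∑ s, cubeProb δ v s *
      (obsRatio c σ s o * Real.log (obsRatio c σ s o))) (c.lawU.prod (noise ℓ σ)) := by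
    refine integrable_finsetSum _ fun s _ => Integrable.const_mul ?_ _
    simp only [obsRatio, Real.log_exp]
    exact (hKL s).1
  have eent : ∫ o, (∑ s, cubeProb δ v s * (obsRatio c σ s o * Real.log (obsRatio c σ s o)))
      ∂(c.lawU.prod (noise ℓ σ)) ≤ ℓ * P / (2 * σ ^ 2) := by
    rw [integral_finsetSum _ fun s _ => Integrable.const_mul
      (by simp only [obsRatio, Real.log_exp]; exact (hKL s).1) _]
    simp only [integral_const_mul, obsRatio, Real.log_exp, (hKL _).2]
    simp only [← mul_div_assoc]
    rw [← Finset.sum_div]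
    gcongr
  have hi := fun i => integrable_chiSq c hσ h0.le h1 v i
  -- The entropy inequality is used for each observation o, with w the likelihood of o as a function
  -- of `s`. Since the mixture integrates to 1, the terms −m + 1 vanish and only the mean relative
  -- entropy to pure noise remains.
  calc ∑ i, chiSq c σ δ v i
      = ∫ o, ∑ i, (mixRatio c σ δ (flipAt i v) o - mixRatio c σ δ v o) ^ 2 / mixRatio c σ δ v o
          ∂(c.lawU.prod (noise ℓ σ)) := (integral_finsetSum _ fun i _ => hi i).symm
    _ ≤ ∫ o, 2 * (4 * δ) ^ 2 * (∑ s, cubeProb δ v s *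
          (obsRatio c σ s o * Real.log (obsRatio c σ s o)) - mixRatio c σ δ v o + 1)
          ∂(c.lawU.prod (noise ℓ σ)) :=
        integral_mono (integrable_finsetSum _ fun i _ => hi i)
          (((ient.sub imix).add (integrable_const 1)).const_mul _)
          fun o => sum_sq_le_entropy h0 h1 v (fun s => obsRatio c σ s o) fun s => Real.exp_pos _
    _ ≤ 2 * (4 * δ) ^ 2 * (ℓ * P / (2 * σ ^ 2)) := by
        have isub : Integrable (fun o : Obs c => ∑ s, cubeProb δ v s * (obsRatio c σ s o *
          Real.log (obsRatio c σ s o)) - mixRatio c σ δ v o) (c.lawU.prod (noise ℓ σ)) :=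
          ient.sub imix
        rw [integral_const_mul, integral_add isub (integrable_const 1),
          integral_sub ient imix, emix]
        simp only [integral_const, probReal_univ, smul_eq_mul, one_mul]
        refine mul_le_mul_of_nonneg_left ?_ (by positivity)
        linarith
    _ = (4 * δ) ^ 2 * (ℓ * (P / σ ^ 2)) := by field_simp

end Mixture

/-! ### Change of measure along the transcript -/

section ChangeOfMeasure

variable {d ℓ T : ℕ} {B P σ : ℝ} {X : Set (Euc d)} {c : Code d ℓ B P}

/-- If the observations have laws `Q` and `Q'` whatever is queried, and `Q'` has density `L` with
respect to `Q`, then the transcripts have the product of the `L` as a density. -/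
lemma lintegral_transcript_eq_mul_prod (π : Algorithm X c T) (O O' : Kernel X (Euc d))
    [IsMarkovKernel O] [IsMarkovKernel O'] {Q Q' : Measure (Obs c)} [IsProbabilityMeasure Q]
    (hQ : ∀ x, observe c σ O x = Q) (hQ' : ∀ x, observe c σ O' x = Q') {L : Obs c → ℝ≥0∞}
    (hL : Measurable L) (hLQ : Q' = Q.withDensity L) (t : ℕ)
    {F : π.W × (Fin t → Obs c) → ℝ≥0∞} (hF : Measurable F) :
    ∫⁻ h, F h ∂(transcript σ π O' t) = ∫⁻ h, F h * ∏ k, L (h.2 k) ∂(transcript σ π O t) := by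
  induction t with
  | zero => simp [transcript]
  | succ t ih =>
    have hs := measurable_snoc_obs π.W (Obs c) t
    have hprod : ∀ t, Measurable fun h : π.W × (Fin t → Obs c) => ∏ k, L (h.2 k) := fun t =>
      Finset.measurable_fun_prod _ fun k _ =>
        hL.comp ((measurable_pi_apply k).comp measurable_snd)
    have hFs : Measurable fun q : (π.W × (Fin t → Obs c)) × Obs c =>
      F (q.1.1, Fin.snoc (α := fun _ => Obs c) q.1.2 q.2) := hF.comp hs
    have hFL : Measurable fun q : (π.W × (Fin t → Obs c)) × Obs c =>
      L q.2 * F (q.1.1, Fin.snoc (α := fun _ => Obs c) q.1.2 q.2) :=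
      (hL.comp measurable_snd).mul hFs
    have hFp : Measurable fun h : π.W × (Fin (t + 1) → Obs c) => F h * ∏ k, L (h.2 k) :=
      hF.mul (hprod _)
    rw [lintegral_transcript_succ σ π O' t hF, lintegral_transcript_succ σ π O t hFp]
    simp only [hQ, hQ', hLQ]
    have e1 : ∀ q : π.W × (Fin t → Obs c),
        ∫⁻ o, F (q.1, Fin.snoc (α := fun _ => Obs c) q.2 o) ∂(Q.withDensity L) =
          ∫⁻ o, L o * F (q.1, Fin.snoc (α := fun _ => Obs c) q.2 o) ∂Q := fun q => by
      have hFq : Measurable fun o => F (q.1, Fin.snoc (α := fun _ => Obs c) q.2 o) :=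
        hFs.comp measurable_prodMk_left
      rw [lintegral_withDensity_eq_lintegral_mul _ hL hFq]
      rfl
    simp only [e1]
    -- The induction hypothesis is applied to the integral over the last observation, as a function
    -- of the earlier ones.
    rw [ih hFL.lintegral_prod_right']
    refine lintegral_congr fun q => ?_
    have hFq : Measurable fun o => L o * F (q.1, Fin.snoc (α := fun _ => Obs c) q.2 o) :=
      hFL.comp measurable_prodMk_left
    rw [← lintegral_mul_const _ hFq]
    refine lintegral_congr fun o => ?_
    simp only [Fin.prod_univ_castSucc, Fin.snoc_castSucc, Fin.snoc_last]
    ring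

/-- Each observation has law Q whatever was queried, so adaptivity creates no dependence. Applied to
the squared likelihood ratio, this makes second moments multiply. -/
lemma lintegral_transcript_prod (π : Algorithm X c T) (O : Kernel X (Euc d))
    [IsMarkovKernel O] {Q : Measure (Obs c)} (hQ : ∀ x, observe c σ O x = Q)
    {L : Obs c → ℝ≥0∞} (hL : Measurable L) (t : ℕ) :
    ∫⁻ h, ∏ k, L (h.2 k) ∂(transcript σ π O t) = (∫⁻ o, L o ∂Q) ^ t := by
  induction t with
  | zero => simp
  | succ t ih =>
    have hprod : Measurable fun h : π.W × (Fin (t + 1) → Obs c) => ∏ k, L (h.2 k) :=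
      Finset.measurable_fun_prod _ fun k _ =>
        hL.comp ((measurable_pi_apply k).comp measurable_snd)
    have hprod' : Measurable fun h : π.W × (Fin t → Obs c) => ∏ k, L (h.2 k) :=
      Finset.measurable_fun_prod _ fun k _ =>
        hL.comp ((measurable_pi_apply k).comp measurable_snd)
    rw [lintegral_transcript_succ σ π O t hprod]
    simp only [Fin.prod_univ_castSucc, Fin.snoc_castSucc, Fin.snoc_last, hQ]
    simp only [lintegral_const_mul _ hL]
    rw [lintegral_mul_const _ hprod', ih, pow_succ]

/-- Expectations of a bounded statistic of the transcript differ by at most what the chi-square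
divergence `χ` of a single observation allows. -/
lemma abs_integral_transcript_sub_le (π : Algorithm X c T) (O O' : Kernel X (Euc d))
    [IsMarkovKernel O] [IsMarkovKernel O'] {Q Q' : Measure (Obs c)} [IsProbabilityMeasure Q]
    (hQ : ∀ x, observe c σ O x = Q) (hQ' : ∀ x, observe c σ O' x = Q') {L : Obs c → ℝ}
    (hL : Measurable L) (hL0 : ∀ o, 0 ≤ L o)
    (hLQ : Q' = Q.withDensity fun o => ENNReal.ofReal (L o)) {χ : ℝ} (hχ : 0 ≤ χ)
    (hL2 : ∫⁻ o, ENNReal.ofReal (L o ^ 2) ∂Q = ENNReal.ofReal (1 + χ)) (t : ℕ)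
    {F : π.W × (Fin t → Obs c) → ℝ} (hF : Measurable F) {b : ℝ} (hb : ∀ h, |F h| ≤ b) :
    |∫ h, F h ∂(transcript σ π O' t) - ∫ h, F h ∂(transcript σ π O t)| ≤
      b * √(Real.exp (t * χ) - 1) := by
  set M := transcript σ π O t with hM
  set M' := transcript σ π O' t with hM'
  set Λ : π.W × (Fin t → Obs c) → ℝ := fun h => ∏ k, L (h.2 k) with hΛ
  have hΛ0 : ∀ h, 0 ≤ Λ h := fun h => Finset.prod_nonneg fun _ _ => hL0 _
  have hΛm : Measurable Λ := Finset.measurable_fun_prod _ fun k _ =>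
    hL.comp ((measurable_pi_apply k).comp measurable_snd)
  have hne : Nonempty (π.W × (Fin t → Obs c)) := nonempty_of_isProbabilityMeasure M
  have hb0 : 0 ≤ b := (abs_nonneg _).trans (hb hne.some)
  have hΛE : ∀ h, ENNReal.ofReal (Λ h) = ∏ k, ENNReal.ofReal (L (h.2 k)) := fun h =>
    ENNReal.ofReal_prod_of_nonneg fun _ _ => hL0 _
  have hdens : M' = M.withDensity fun h => ENNReal.ofReal (Λ h) := by
    refine Measure.ext_of_lintegral _ fun G hG => ?_
    rw [lintegral_withDensity_eq_lintegral_mul _ hΛm.ennreal_ofReal hG, hM',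
      lintegral_transcript_eq_mul_prod π O O' hQ hQ' hL.ennreal_ofReal hLQ t hG]
    refine lintegral_congr fun h => ?_
    rw [Pi.mul_apply, hΛE, mul_comm]
  have hsq : ∫⁻ h, ENNReal.ofReal (Λ h ^ 2) ∂M = ENNReal.ofReal ((1 + χ) ^ t) := by
    have h1 := lintegral_transcript_prod π O hQ (hL.pow_const 2).ennreal_ofReal t
    rw [hL2, ← ENNReal.ofReal_pow (by positivity)] at h1
    rw [← h1]
    refine lintegral_congr fun h => ?_
    rw [hΛ, ← Finset.prod_pow, ENNReal.ofReal_prod_of_nonneg fun _ _ => sq_nonneg _]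
  have i2 : Integrable (fun h => Λ h ^ 2) M := by
    refine ⟨(hΛm.pow_const 2).aestronglyMeasurable, ?_⟩
    rw [hasFiniteIntegral_iff_ofReal (ae_of_all _ fun _ => sq_nonneg _), hsq]
    exact ENNReal.ofReal_lt_top
  have e2 : ∫ h, Λ h ^ 2 ∂M = (1 + χ) ^ t := by
    rw [integral_eq_lintegral_of_nonneg_ae (ae_of_all _ fun _ => sq_nonneg _)
      (hΛm.pow_const 2).aestronglyMeasurable, hsq, ENNReal.toReal_ofReal (by positivity)]
  have l2 : MemLp Λ 2 M := (memLp_two_iff_integrable_sq hΛm.aestronglyMeasurable).2 i2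
  have i1 : Integrable Λ M := l2.integrable (by norm_num)
  have e1 : ∫ h, Λ h ∂M = 1 := by
    have h1 : ∫⁻ h, ENNReal.ofReal (Λ h) ∂M = 1 := by
      rw [← setLIntegral_univ, ← withDensity_apply _ MeasurableSet.univ, ← hdens, measure_univ]
    rw [integral_eq_lintegral_of_nonneg_ae (ae_of_all _ hΛ0) hΛm.aestronglyMeasurable, h1,
      ENNReal.toReal_one]
  have iF : Integrable F M := Integrable.of_bound hF.aestronglyMeasurable b (ae_of_all _ hb)
  have iΛF : Integrable (fun h => Λ h * F h) M :=
    i1.mul_bdd hF.aestronglyMeasurable (ae_of_all _ hb)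
  have eF : ∫ h, F h ∂M' = ∫ h, Λ h * F h ∂M := by
    rw [hdens, integral_withDensity_eq_integral_toReal_smul hΛm.ennreal_ofReal
      (ae_of_all _ fun _ => ENNReal.ofReal_lt_top)]
    refine integral_congr_ae (ae_of_all _ fun h => ?_)
    simp only [ENNReal.toReal_ofReal (hΛ0 h), smul_eq_mul]
  set Y : π.W × (Fin t → Obs c) → ℝ := fun h => |Λ h - 1| with hY
  have lY : MemLp Y 2 M := (l2.sub (memLp_const 1)).abs
  have iY : Integrable Y M := lY.integrable (by norm_num)
  have eY2 : ∫ h, Y h ^ 2 ∂M = (1 + χ) ^ t - 1 := by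
    have : ∀ h, Y h ^ 2 = Λ h ^ 2 - 2 * Λ h + 1 := fun h => by rw [hY, sq_abs]; ring
    simp only [this]
    have isub : Integrable (fun h => Λ h ^ 2 - 2 * Λ h) M := i2.sub (i1.const_mul 2)
    rw [integral_add isub (integrable_const _),
      integral_sub i2 (i1.const_mul 2), integral_const_mul, e1, e2]
    simp only [integral_const, probReal_univ, smul_eq_mul, one_mul]
    ring
  -- Cauchy–Schwarz in the form of a nonnegative variance, followed by 1 + χ ≤ exp χ.
  have hYle : ∫ h, Y h ∂M ≤ √(Real.exp (t * χ) - 1) := by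
    refine Real.le_sqrt_of_sq_le ?_
    have hv := variance_nonneg Y M
    rw [variance_eq_sub lY] at hv
    simp only [Pi.pow_apply, eY2] at hv
    have hexp : (1 + χ) ^ t ≤ Real.exp (t * χ) := by
      rw [Real.exp_nat_mul]
      exact pow_le_pow_left₀ (by positivity) (by linarith [Real.add_one_le_exp χ]) t
    linarith
  rw [eF, ← integral_sub iΛF iF]
  refine (abs_integral_le_integral_abs).trans ?_
  calc ∫ h, |Λ h * F h - F h| ∂M ≤ ∫ h, b * Y h ∂M := by
        refine integral_mono (iΛF.sub iF).abs (iY.const_mul b) fun h => ?_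
        have e : Λ h * F h - F h = (Λ h - 1) * F h := by ring
        simp only [e, abs_mul, hY]
        rw [mul_comm b]
        exact mul_le_mul_of_nonneg_left (hb h) (abs_nonneg _)
    _ = b * ∫ h, Y h ∂M := integral_const_mul _ _
    _ ≤ _ := mul_le_mul_of_nonneg_left hYle hb0

end ChangeOfMeasure

/-! ### The lower bound -/

section Lower

variable {d ℓ : ℕ} {B P σ δ b : ℝ}

/-- The cube of side `2b`. -/
def cube (d : ℕ) (b : ℝ) : Set (Euc d) := {x | ∀ i, |x i| ≤ b}

lemma convex_cube (b : ℝ) : Convex ℝ (cube d b) := by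
  intro x hx y hy r s hr hs hrs i
  have h : (r • x + s • y) i = r * x i + s * y i := rfl
  rw [h]
  calc |r * x i + s * y i| ≤ |r * x i| + |s * y i| := abs_add_le _ _
    _ = r * |x i| + s * |y i| := by rw [abs_mul, abs_mul, abs_of_nonneg hr, abs_of_nonneg hs]
    _ ≤ r * b + s * b := add_le_add (mul_le_mul_of_nonneg_left (hx i) hr)
        (mul_le_mul_of_nonneg_left (hy i) hs)
    _ = b := by rw [← add_mul, hrs, one_mul]

lemma cube_mem_domains (hb : 0 ≤ b) : cube d b ∈ domains d (2 * b * √d) := by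
  refine ⟨⟨0, fun i => by simpa using hb⟩, convex_cube b, fun x hx y hy => ?_⟩
  refine le_of_sq_le_sq ?_ (by positivity)
  rw [EuclideanSpace.norm_sq_eq, mul_pow, Real.sq_sqrt (by positivity)]
  calc ∑ i, ‖(x - y) i‖ ^ 2 ≤ ∑ _i : Fin d, (2 * b) ^ 2 := by
        refine Finset.sum_le_sum fun i _ => pow_le_pow_left₀ (norm_nonneg _) ?_ 2
        have h : (x - y) i = x i - y i := rfl
        rw [h, Real.norm_eq_abs]
        have h2 := abs_sub (x i) (y i)
        linarith [hx i, hy i]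
    _ = (2 * b) ^ 2 * d := by simp [mul_comm]

/-- The hard instance with sign vector `v`: a linear function and the biased sign oracle. -/
def hardInstance (hd : 1 ≤ d) (B b : ℝ) (h0 : 0 ≤ δ) (h1 : δ < 1) (v : Fin d → Bool) :
    Instance (cube d b) B where
  f x := inner ℝ (δ • gradVec B v) x
  convex := ⟨convex_cube b, fun x _ y _ r s _ _ _ => by
    simp only [inner_add_right, inner_smul_right, smul_eq_mul, le_refl]⟩
  O := Kernel.const _ (gradLaw B δ v)
  markov := by
    have := isProbabilityMeasure_gradLaw B h0 h1 v
    infer_instance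
  unbiased x := by
    intro y _
    rw [Kernel.const_apply, integral_gradLaw B h0 h1, inner_sub_right]
    linarith
  meanSquare x := by
    rw [Kernel.const_apply, lintegral_norm_sq_gradLaw hd B h0 h1]

lemma inner_smul_gradVec (v : Fin d → Bool) (x : Euc d) :
    inner ℝ (δ • gradVec B v) x = δ * B / √d * ∑ i, sgn (v i) * x i := by
  rw [inner_smul_left, PiLp.inner_apply, Finset.mul_sum, Finset.mul_sum]
  refine Finset.sum_congr rfl fun i _ => ?_
  simp only [gradVec, RCLike.inner_apply, conj_trivial]
  ring

/-- The expectation of a coordinate of the output, shifted by `b` so as to measure its error for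
the hard instance with sign vector `v`. -/
def coordError {T : ℕ} {c : Code d ℓ B P} (σ : ℝ) (π : Algorithm (cube d b) c T) (hd : 1 ≤ d)
    (h0 : 0 ≤ δ) (h1 : δ < 1) (v : Fin d → Bool) (i : Fin d) : ℝ :=
  sgn (v i) * ∫ h, (π.output h : Euc d) i ∂(transcript σ π (hardInstance hd B b h0 h1 v).O T) + b

variable {T : ℕ} {c : Code d ℓ B P} (π : Algorithm (cube d b) c T)

lemma measurable_output_apply (i : Fin d) : Measurable fun h => (π.output h : Euc d) i := by
  have := π.measurable_output
  fun_prop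

lemma integrable_output_apply (I : Instance (cube d b) B) (i : Fin d) :
    Integrable (fun h => (π.output h : Euc d) i) (transcript σ π I.O T) :=
  Integrable.of_bound (measurable_output_apply π i).aestronglyMeasurable b
    (ae_of_all _ fun h => (π.output h).2 i)

lemma coordError_nonneg (hd : 1 ≤ d) (h0 : 0 ≤ δ) (h1 : δ < 1) (v : Fin d → Bool) (i : Fin d) :
    0 ≤ coordError σ π hd h0 h1 v i := by
  have h : |∫ h, (π.output h : Euc d) i ∂(transcript σ π (hardInstance hd B b h0 h1 v).O T)| ≤ b := by
    have hb : ∀ h, ‖(π.output h : Euc d) i‖ ≤ b := fun h => (π.output h).2 i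
    refine (norm_integral_le_of_norm_le_const (ae_of_all _ hb)).trans ?_
    simp
  have h2 := neg_abs_le (sgn (v i) *
    ∫ h, (π.output h : Euc d) i ∂(transcript σ π (hardInstance hd B b h0 h1 v).O T))
  rw [abs_mul, abs_sgn, one_mul] at h2
  rw [coordError]
  linarith

/-- The error of an algorithm on a hard instance is the sum of the coordinate errors. -/
lemma le_convError_hardInstance (hd : 1 ≤ d) (hb : 0 ≤ b) (h0 : 0 ≤ δ) (h1 : δ < 1)
    (v : Fin d → Bool) :
    δ * B / √d * ∑ i, coordError σ π hd h0 h1 v i ≤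
      convError σ π (hardInstance hd B b h0 h1 v) := by
  set I := hardInstance hd B b h0 h1 v with hI
  have hf : ∀ x, I.f x = δ * B / √d * ∑ i, sgn (v i) * x i := inner_smul_gradVec v
  -- The vertex of the cube opposite to v, where each coordinate contributes −b.
  let x₀ : Euc d := WithLp.toLp 2 fun i => -(b * sgn (v i))
  have hx₀ : x₀ ∈ cube d b := fun i => by
    change |-(b * sgn (v i))| ≤ b
    rw [abs_neg, abs_mul, abs_sgn, mul_one, abs_of_nonneg hb]
  have hmin : ⨅ x : cube d b, I.f x ≤ δ * B / √d * ∑ _i : Fin d, -b := by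
    refine (ciInf_le (I.bddBelow_range (cube_mem_domains hb)) ⟨x₀, hx₀⟩).trans (le_of_eq ?_)
    rw [hf]
    congr 1
    refine Finset.sum_congr rfl fun i _ => ?_
    change sgn (v i) * -(b * sgn (v i)) = -b
    linear_combination (-b) * sgn_mul_self (v i)
  have hint : ∫ h, I.f (π.output h) ∂(transcript σ π I.O T) =
      δ * B / √d * ∑ i, sgn (v i) * ∫ h, (π.output h : Euc d) i ∂(transcript σ π I.O T) := by
    simp only [hf]
    rw [integral_const_mul,
      integral_finsetSum _ fun i _ => (integrable_output_apply π I i).const_mul _]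
    simp only [integral_const_mul]
  rw [convError, hint]
  have e : ∑ i, coordError σ π hd h0 h1 v i =
      ∑ i, sgn (v i) * ∫ h, (π.output h : Euc d) i ∂(transcript σ π I.O T) -
        ∑ _i : Fin d, -b := by
    rw [← Finset.sum_sub_distrib]
    exact Finset.sum_congr rfl fun i _ => by rw [coordError, sub_neg_eq_add]
  rw [e, mul_sub]
  linarith

/-- Reversing one sign: a coordinate error is large for one of the two instances unless the
observations tell them apart. -/
lemma le_coordError_add_coordError_flipAt (hd : 1 ≤ d) (hσ : 0 < σ) (hb : 0 ≤ b)
    (h0 : 0 ≤ δ) (h1 : δ ≤ 1 / 2) (hδ : δ < 1) (v : Fin d → Bool) (i : Fin d) :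
    b * (1 - T * chiSq c σ δ v i) ≤
      coordError σ π hd h0 hδ v i + coordError σ π hd h0 hδ (flipAt i v) i := by
  set χ := chiSq c σ δ v i with hχdef
  have hχ : 0 ≤ χ := chiSq_nonneg c h0 hδ v i
  set μ := c.lawU.prod (noise ℓ σ) with hμ
  set m := mixRatio c σ δ v with hm
  set m' := mixRatio c σ δ (flipAt i v) with hm'
  have mpos : ∀ o, 0 < m o := mixRatio_pos c h0 hδ v
  have mpos' : ∀ o, 0 < m' o := mixRatio_pos c h0 hδ (flipAt i v)
  have mm : Measurable m := measurable_mixRatio c σ δ v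
  have mm' : Measurable m' := measurable_mixRatio c σ δ (flipAt i v)
  have mL : Measurable fun o => m' o / m o := mm'.div mm
  obtain ⟨im, em⟩ := integral_mixRatio c hσ h0 hδ v
  obtain ⟨im', em'⟩ := integral_mixRatio c hσ h0 hδ (flipAt i v)
  have ichi := integrable_chiSq c hσ h0 h1 v i
  have hQ := fun x => observe_eq_withDensity c hσ h0 hδ v (hardInstance hd B b h0 hδ v).O x rfl
  have hQ' := fun x => observe_eq_withDensity c hσ h0 hδ (flipAt i v)
    (hardInstance hd B b h0 hδ (flipAt i v)).O x rfl
  have hprob : IsProbabilityMeasure (μ.withDensity fun o => ENNReal.ofReal (m o)) := by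
    rw [← hQ ⟨0, fun i => by simpa using hb⟩]; infer_instance
  have hdens : (μ.withDensity fun o => ENNReal.ofReal (m' o)) =
      (μ.withDensity fun o => ENNReal.ofReal (m o)).withDensity
        fun o => ENNReal.ofReal (m' o / m o) := by
    rw [← withDensity_mul _ mm.ennreal_ofReal mL.ennreal_ofReal]
    congr 1
    ext o
    rw [Pi.mul_apply, ← ENNReal.ofReal_mul (mpos o).le, mul_div_cancel₀ _ (mpos o).ne']
  have hL2 : ∫⁻ o, ENNReal.ofReal ((m' o / m o) ^ 2)
      ∂(μ.withDensity fun o => ENNReal.ofReal (m o)) = ENNReal.ofReal (1 + χ) := by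
    -- m'²/m = (m' − m)²/m + 2m' − m, and both mixtures integrate to 1, whence the second moment 1 +
    -- χ.
    have e : ∀ o, m o * (m' o / m o) ^ 2 = (m' o - m o) ^ 2 / m o + (2 * m' o - m o) := fun o => by
      have := (mpos o).ne'
      field_simp
      ring
    have isub : Integrable (fun o => 2 * m' o - m o) μ := (im'.const_mul 2).sub im
    have iall : Integrable (fun o => m o * (m' o / m o) ^ 2) μ := by
      simp only [e]; exact ichi.add isub
    have hval : ∫ o, m o * (m' o / m o) ^ 2 ∂μ = 1 + χ := by
      simp only [e]
      rw [integral_add ichi isub, integral_sub (im'.const_mul 2) im, integral_const_mul, em, em',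
        hχdef, chiSq]
      ring
    rw [lintegral_withDensity_eq_lintegral_mul _ mm.ennreal_ofReal
      (mL.pow_const 2).ennreal_ofReal, ← hval,
      ofReal_integral_eq_lintegral_ofReal iall
        (ae_of_all _ fun o => mul_nonneg (mpos o).le (sq_nonneg _))]
    refine lintegral_congr fun o => ?_
    rw [Pi.mul_apply, ← ENNReal.ofReal_mul (mpos o).le]
  have key := abs_integral_transcript_sub_le (σ := σ) π (hardInstance hd B b h0 hδ v).O
    (hardInstance hd B b h0 hδ (flipAt i v)).O hQ hQ' mL
    (fun o => div_nonneg (mpos' o).le (mpos o).le) hdens hχ hL2 T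
    (measurable_output_apply π i) (fun h => (π.output h).2 i)
  have hn1 := coordError_nonneg (σ := σ) π hd h0 hδ v i
  have hn2 := coordError_nonneg (σ := σ) π hd h0 hδ (flipAt i v) i
  -- If Tχ ≥ 1 the left side is nonpositive and nonnegativity of the errors suffices.
  rcases le_or_gt 1 (T * χ) with hT | hT
  · nlinarith
  · have hTχ : 0 ≤ T * χ := by positivity
    -- For 0 ≤ x < 1, eˣ − 1 ≤ x + x² ≤ (1 + x)². This is crude, but linear in χ, so that the bound
    -- can be summed over the coordinates.
    have hsqrt : √(Real.exp (T * χ) - 1) ≤ 1 + T * χ := by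
      refine Real.sqrt_le_iff.2 ⟨by positivity, ?_⟩
      have h3 := Real.abs_exp_sub_one_sub_id_le (x := T * χ) (by rw [abs_of_nonneg hTχ]; exact hT.le)
      have h4 := (abs_le.1 h3).2
      nlinarith
    have h5 := mul_le_mul_of_nonneg_left hsqrt hb
    unfold coordError at hn1 hn2 ⊢
    rw [flipAt_apply_self, sgn_not] at hn2 ⊢
    set x := ∫ h, (π.output h : Euc d) i ∂(transcript σ π (hardInstance hd B b h0 hδ v).O T)
    set x' := ∫ h, (π.output h : Euc d) i
      ∂(transcript σ π (hardInstance hd B b h0 hδ (flipAt i v)).O T)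
    have h6 : |sgn (v i) * (x' - x)| ≤ b * √(Real.exp (T * χ) - 1) := by
      rw [abs_mul, abs_sgn, one_mul]; exact key
    have h7 := (abs_le.1 h6).2
    nlinarith

/-- Some hard instance has a large error. -/
lemma exists_le_convError (hd : 1 ≤ d) (hB : 0 < B) (hP : 0 < P) (hσ : 0 < σ) (hb : 0 ≤ b)
    (h0 : 0 < δ) (h1 : δ ≤ 1 / 2) (hcap : (4 * δ) ^ 2 * (T * (ℓ * (P / σ ^ 2))) ≤ d / 4) :
    ∃ I : Instance (cube d b) B, 3 / 8 * δ * B * √d * b ≤ convError σ π I := by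
  have hδ : δ < 1 := by linarith
  have hd' : (0 : ℝ) < d := by exact_mod_cast hd
  let E : (Fin d → Bool) → Fin d → ℝ := coordError σ π hd h0.le hδ
  -- By `sum_chiSq_le` and `hcap`, the quantities Tχᵢ add up to at most d/4.
  have hpair : ∀ v, b * (3 / 4 * d) ≤ ∑ i, (E v i + E (flipAt i v) i) := by
    intro v
    refine le_trans ?_ (Finset.sum_le_sum fun i _ =>
      le_coordError_add_coordError_flipAt (σ := σ) π hd hσ hb h0.le h1 hδ v i)
    rw [← Finset.mul_sum, Finset.sum_sub_distrib, ← Finset.mul_sum]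
    refine mul_le_mul_of_nonneg_left ?_ hb
    have h2 := mul_le_mul_of_nonneg_left (sum_chiSq_le c hd hP hσ h0 h1 v)
      (Nat.cast_nonneg (α := ℝ) T)
    simp only [Finset.sum_const, Finset.card_univ, Fintype.card_fin, nsmul_eq_mul, mul_one]
    nlinarith
  -- Reversing the i-th sign permutes the sign vectors, so both terms of a pair have the same
  -- average over v; this halves 3/4 to 3/8.
  have hflip : ∑ v, ∑ i, E (flipAt i v) i = ∑ v, ∑ i, E v i := by
    rw [Finset.sum_comm, Finset.sum_comm (f := fun v i => E v i)]
    refine Finset.sum_congr rfl fun i _ => ?_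
    exact Equiv.sum_comp (Function.Involutive.toPerm (flipAt i) (flipAt_flipAt i)) fun v => E v i
  have htot : ∑ _v : Fin d → Bool, b * (3 / 8 * d) ≤ ∑ v, ∑ i, E v i := by
    have h2 := Finset.sum_le_sum fun v (_ : v ∈ Finset.univ) => hpair v
    simp only [Finset.sum_add_distrib] at h2
    rw [hflip] at h2
    have e : ∑ _v : Fin d → Bool, b * (3 / 4 * d) =
        2 * ∑ _v : Fin d → Bool, b * (3 / 8 * (d : ℝ)) := by
      rw [Finset.mul_sum]; exact Finset.sum_congr rfl fun _ _ => by ring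
    rw [e] at h2
    linarith
  obtain ⟨v, -, hv⟩ := Finset.exists_le_of_sum_le Finset.univ_nonempty htot
  refine ⟨hardInstance hd B b h0.le hδ v,
    le_trans ?_ (le_convError_hardInstance (σ := σ) π hd hb h0.le hδ v)⟩
  have hs : √(d : ℝ) * √d = d := Real.mul_self_sqrt hd'.le
  calc 3 / 8 * δ * B * √d * b = δ * B / √d * (b * (3 / 8 * d)) := by
        have : √(d : ℝ) ≠ 0 := (Real.sqrt_pos.2 hd').ne'
        field_simp
        rw [sq, hs, mul_comm]
    _ ≤ δ * B / √d * ∑ i, E v i := mul_le_mul_of_nonneg_left hv (by positivity)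

end Lower

/-- The lower bound for all codes. -/
lemma le_minimaxError_allCodes {d N : ℕ} {D B P σ SNR : ℝ} (hd : 1 ≤ d) (hD : 0 < D)
    (hB : 0 < B) (hP : 0 < P) (hσ : 0 < σ) (hS : SNR = P / σ ^ 2) (hS1 : SNR ∈ Set.Ioo (0 : ℝ) 1)
    (hN : (d : ℝ) / Real.logb 2 (1 + SNR) ≤ (N : ℝ)) :
    ((1 / 64 * (D * B / √N * √(d / Real.logb 2 (1 + SNR))) : ℝ) : EReal) ≤
      minimaxError (allCodes d B P) D σ N := by
  obtain ⟨hs0, hs1⟩ := hS1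
  set C := Real.logb 2 (1 + SNR) with hC
  have hd' : (0 : ℝ) < d := by exact_mod_cast hd
  have hC0 : 0 < C := Real.logb_pos (by norm_num) (by linarith)
  have hCs : SNR ≤ C := le_logb hs0 hs1
  have hdC : 0 < d / C := by positivity
  have hN0 : (0 : ℝ) < N := lt_of_lt_of_le hdC hN
  -- The claimed rate is D·B·r. The hypothesis on N says r ≤ 1, which makes the bias δ = r/8
  -- admissible.
  set r := √(d / C) / √N with hr
  have hr0 : 0 < r := by positivity
  have hr1 : r ≤ 1 := by
    rw [hr, div_le_one (by positivity)]
    exact Real.sqrt_le_sqrt hN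
  have hr2 : r ^ 2 = d / C / N := by
    rw [hr, div_pow, Real.sq_sqrt hdC.le, Real.sq_sqrt hN0.le]
  -- Makes the diagonal of the cube exactly D.
  set b := D / (2 * √d) with hb
  have hsd : 0 < √(d : ℝ) := Real.sqrt_pos.2 hd'
  have hX : cube d b ∈ domains d D := by
    have h := cube_mem_domains (d := d) (b := b) (by positivity)
    have e : 2 * b * √d = D := by rw [hb]; field_simp
    rwa [e] at h
  refine le_trans ?_ (le_iSup₂_of_le (cube d b) hX le_rfl)
  refine le_iInf₂ fun ℓ _ => le_iInf₂ fun T hT => le_iInf₂ fun c _ => le_iInf fun π => ?_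
  -- Here (4δ)² = r²/4 = d/(4CN), while T·ℓ·SNR ≤ N·C.
  have hcap : (4 * (r / 8)) ^ 2 * (T * (ℓ * (P / σ ^ 2))) ≤ d / 4 := by
    have hT' : (T : ℝ) * ℓ ≤ N := by
      rw [mul_comm]; exact_mod_cast hT
    rw [← hS]
    have h2 : (T : ℝ) * (ℓ * SNR) ≤ N * C := by
      rw [← mul_assoc]
      exact mul_le_mul hT' hCs hs0.le hN0.le
    calc (4 * (r / 8)) ^ 2 * (T * (ℓ * SNR)) = r ^ 2 / 4 * (T * (ℓ * SNR)) := by ring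
      _ ≤ r ^ 2 / 4 * (N * C) := mul_le_mul_of_nonneg_left h2 (by positivity)
      _ = d / 4 := by rw [hr2]; field_simp
  obtain ⟨I, hI⟩ := exists_le_convError (σ := σ) (b := b) (δ := r / 8) π hd hB hP hσ (by positivity)
    (by positivity) (by linarith) hcap
  refine le_trans (EReal.coe_le_coe_iff.2 (le_trans ?_ hI)) (le_iSup (fun I : Instance (cube d b) B =>
    (convError σ π I : EReal)) I)
  -- The resulting constant 3/128 exceeds the required 1/64.
  have e : 3 / 8 * (r / 8) * B * √d * b = 3 / 128 * (D * B * r) := by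
    rw [hb]; field_simp; norm_num
  have e2 : D * B / √N * √(d / C) = D * B * r := by rw [hr]; ring
  rw [e, e2]
  have : 0 ≤ D * B * r := by positivity
  linarith

end

end OverTheAir

theorem corollary1 :
    ∃ c₁ c₂ : ℝ, 0 < c₁ ∧ 0 < c₂ ∧
      ∀ (d N : ℕ) (D B P σ SNR : ℝ), 1 ≤ d → 0 < D → 0 < B → 0 < P → 0 < σ →
        SNR = P / σ ^ 2 → SNR ∈ Set.Ioo (0 : ℝ) 1 →
        (d : ℝ) / Real.logb 2 (1 + SNR) ≤ (N : ℝ) →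
        -- two-sided bound on the min-max error of analog codes
        ((c₁ * (D * B / √N * √(d / Real.logb 2 (1 + SNR))) : ℝ) : EReal) ≤
            OverTheAir.minimaxError (OverTheAir.analogCodes d B P) D σ N ∧
        OverTheAir.minimaxError (OverTheAir.analogCodes d B P) D σ N ≤
          ((c₂ * (D * B / √N * √(d / Real.logb 2 (1 + SNR))) : ℝ) : EReal) ∧
        -- optimality: no code does better in order, and scaled transmission attains the order
        ((c₁ * (D * B / √N * √(d / Real.logb 2 (1 + SNR))) : ℝ) : EReal) ≤
            OverTheAir.minimaxError (OverTheAir.allCodes d B P) D σ N ∧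
        OverTheAir.minimaxError (OverTheAir.scaledTransmission d B P) D σ N ≤
          ((c₂ * (D * B / √N * √(d / Real.logb 2 (1 + SNR))) : ℝ) : EReal) := by
  refine ⟨1 / 64, 5, by norm_num, by norm_num, fun d N D B P σ SNR hd hD hB hP hσ hS hS1 hN => ?_⟩
  have hlow := OverTheAir.le_minimaxError_allCodes hd hD hB hP hσ hS hS1 hN
  have hup := OverTheAir.minimaxError_scaledTransmission_le hd hD hB hP hσ hS hS1 hN
  exact ⟨hlow.trans (OverTheAir.minimaxError_anti (fun _ => Set.subset_univ _) D σ N),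
    (OverTheAir.minimaxError_anti
      (OverTheAir.scaledTransmission_subset_analogCodes d B P) D σ N).trans hup, hlow, hup⟩
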